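/- Let $(\Omega,\mathcal F,\mathbb P)$ be a probability space and let $\{C(t)\}_{t\ge 0}$ be a non-negative, non-decreasing process with continuous paths and $C(0)=0$. Let $\alpha>0$, $\beta\in\mathbb R$, and let $K$ assign to each pair $0\le s<t$ a number $K(s,t)\in(0,\infty)$, non-decreasing with respect to inclusion of intervals (that is, $K(s',t')\le K(s,t)$ whenever $s\le s'<t'\le t$). Assume that for every $m\in\mathbb N$, every decreasing sequence $d_1>d_2>\dots>d_m>0$ and all $0=t_0<t_1<\dots<t_m$, $$\lim_{\varepsilon\downarrow0}\varepsilon^{\alpha}|\log\varepsilon|^{\beta}\log\mathbb P\Big(\sum_{i=1}^m d_i\,(C(t_i)-C(t_{i-1}))\le\varepsilon\Big)=-\Big(\sum_{i=1}^m\big(d_i^{\alpha}K(t_{i-1},t_i)\big)^{1/(1+\alpha)}\Big)^{1+\alpha}.$$ Let $B$ be a standard real-valued Brownian motion independent of $C$, and put $Z(t)=B(C(t))$ and $M(t)=\sup_{0\le s\le t}|Z(s)|$. Then, for any $m\in\mathbb N$, $0=t_0<t_1<\dots<t_m<\infty$ and $0\le a_1<b_1\le a_2<b_2\le\dots\le a_m<b_m$,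 $$\lim_{\varepsilon\downarrow0}\varepsilon^{2\alpha/(1+\alpha)}|\log\varepsilon|^{\beta/(1+\alpha)}\log\mathbb P\Big(\bigcap_{i=1}^m\{a_i\varepsilon\le M(t_i)\le b_i\varepsilon\}\Big)=-2^{-\beta/(1+\alpha)}(1+\alpha)^{1+\beta/(1+\alpha)}\Big(\frac{\pi^2}{8\alpha}\Big)^{\alpha/(1+\alpha)}\sum_{i=1}^m\Big(\frac{K(t_{i-1},t_i)}{b_i^{2\alpha}}\Big)^{1/(1+\alpha)}.$$ -/

import Mathlib

open MeasureTheory ProbabilityTheory Filter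
open scoped NNReal Topology

/-- A random clock satisfying the multi-interval small-ball assumption with parameters
`α`, `β` and `K`: a non-negative process `C`, with (almost surely) continuous non-decreasing
paths started at `0`, such that every weighted sum of increments
`∑ i, d i * (C (t i) - C (t (i-1)))`, with decreasing positive weights, has the prescribed
logarithmic small-ball asymptotics. The function `K` is a positive function of intervals
`(s, t)`, non-decreasing with respect to inclusion of intervals.
The points `t 0 = 0 < t 1 < ⋯ < t m` are indexed by `Fin (m + 1)`, the intervals by `Fin m`. -/
structure IsSmallBallClock {Ω : Type*} [MeasurableSpace Ω] (C : ℝ≥0 → Ω → ℝ≥0) (P : Measure Ω)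
    (α β : ℝ) (K : ℝ≥0 → ℝ≥0 → ℝ) : Prop where
  aemeasurable : ∀ t, AEMeasurable (C t) P
  continuous : ∀ᵐ ω ∂P, Continuous fun t ↦ C t ω
  monotone : ∀ᵐ ω ∂P, Monotone fun t ↦ C t ω
  zero : ∀ᵐ ω ∂P, C 0 ω = 0
  alpha_pos : 0 < α
  K_pos : ∀ s t, s < t → 0 < K s t
  K_mono : ∀ s s' t' t, s ≤ s' → s' < t' → t' ≤ t → K s' t' ≤ K s t
  small_ball : ∀ (m : ℕ) (d : Fin m → ℝ) (t : Fin (m + 1) → ℝ≥0),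
    (∀ i, 0 < d i) → StrictAnti d → t 0 = 0 → StrictMono t →
    Tendsto
      (fun ε : ℝ ↦ ε ^ α * |Real.log ε| ^ β *
        Real.log (P.real {ω |
          ∑ i : Fin m, d i * ((C (t i.succ) ω : ℝ) - (C (t i.castSucc) ω : ℝ)) ≤ ε}))
      (𝓝[>] 0)
      (𝓝 (-(∑ i : Fin m, (d i ^ α * K (t i.castSucc) (t i.succ)) ^ (1 / (1 + α))) ^ (1 + α)))

/-- The time-changed process `Z(t) = B(C(t))`. -/
def timeChange {Ω : Type*} (B : ℝ≥0 → Ω → ℝ) (C : ℝ≥0 → Ω → ℝ≥0) : ℝ≥0 → Ω → ℝ :=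
  fun t ω ↦ B (C t ω) ω

/-- The running maximum `M(t) = sup_{0 ≤ s ≤ t} |Z(s)|`. The supremum is that of a bounded
nonempty set for every path that is continuous. -/
noncomputable def runningMax {Ω : Type*} (Z : ℝ≥0 → Ω → ℝ) (t : ℝ≥0) (ω : Ω) : ℝ :=
  ⨆ s : Set.Iic t, |Z s ω|

/-- The σ-algebra generated by a real process up to time `s`. -/
abbrev pastSigma {Ω : Type*} (B : ℝ≥0 → Ω → ℝ) (s : ℝ≥0) : MeasurableSpace Ω :=
  MeasurableSpace.comap (fun ω (r : Set.Iic s) ↦ B r ω) MeasurableSpace.pi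

lemma measurable_pastSigma {Ω : Type*} (B : ℝ≥0 → Ω → ℝ) {r s : ℝ≥0} (h : r ≤ s) :
    Measurable[pastSigma B s] (B r) := by
  have h1 : Measurable[pastSigma B s] (fun ω (r : Set.Iic s) ↦ B r ω) :=
    comap_measurable _
  exact (measurable_pi_apply (⟨r, h⟩ : Set.Iic s)).comp h1

lemma pastSigma_mono {Ω : Type*} (B : ℝ≥0 → Ω → ℝ) {s t : ℝ≥0} (h : s ≤ t) :
    pastSigma B s ≤ pastSigma B t := by
  have h1 : Measurable[pastSigma B t] (fun ω (r : Set.Iic s) ↦ B r ω) :=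
    @measurable_pi_lambda _ _ _ (pastSigma B t) _ _
      fun r ↦ measurable_pastSigma B (r.2.trans h)
  exact h1.comap_le

lemma pastSigma_le {Ω : Type*} [mΩ : MeasurableSpace Ω] {B : ℝ≥0 → Ω → ℝ}
    (hm : ∀ t, Measurable (B t)) (s : ℝ≥0) : pastSigma B s ≤ mΩ := by
  have h1 : Measurable (fun ω (r : Set.Iic s) ↦ B r ω) := measurable_pi_lambda _ fun r ↦ hm r
  exact h1.comap_le

section

variable {Ω : Type*} [mΩ : MeasurableSpace Ω] {P : Measure Ω} {B : ℝ≥0 → Ω → ℝ}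

lemma hasLaw_increment (hB : IsPreBrownianReal B P) (s h : ℝ≥0) :
    HasLaw (fun ω ↦ B (s + h) ω - B s ω) (gaussianReal 0 h) P := by
  have := hB.hasLaw_sub (s + h) s
  have h1 : nndist (s + h).1 s.1 = h := by
    apply NNReal.coe_injective
    change dist ((s + h : ℝ≥0) : ℝ) (s : ℝ) = h
    simp
  rw [h1] at this
  exact this

lemma integral_cexp_increment (hB : IsPreBrownianReal B P) (s h : ℝ≥0) (θ : ℝ) :
    ∫ ω, Complex.exp (θ * (B (s + h) ω - B s ω) * Complex.I) ∂P =
      Complex.exp (-(h * θ ^ 2 / 2)) := by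
  have h1 := charFun_gaussianReal (μ := 0) (v := h) θ
  have hl := hasLaw_increment hB s h
  rw [charFun_apply_real] at h1
  have h2 := hl.integral_comp (f := fun x : ℝ ↦ Complex.exp (θ * x * Complex.I))
    (by fun_prop)
  rw [h1] at h2
  simp only [Function.comp_def] at h2
  simpa using h2

/-- The martingale property of `cos (θ B t) * exp (θ² t / 2)`. -/
lemma setIntegral_cos_add (hB : IsPreBrownianReal B P) (hm : ∀ t, Measurable (B t))
    (s h : ℝ≥0) (θ : ℝ) {G : Set Ω} (hG : MeasurableSet[pastSigma B s] G) :
    ∫ ω in G, Real.cos (θ * B (s + h) ω) ∂P =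
      Real.exp (-(h * θ ^ 2 / 2)) * ∫ ω in G, Real.cos (θ * B s ω) ∂P := by
  have : IsProbabilityMeasure P := hB.isGaussianProcess.isProbabilityMeasure
  have hGm : MeasurableSet G := pastSigma_le hm s G hG
  let X : Ω → ℂ := G.indicator fun ω ↦ Complex.exp (θ * B s ω * Complex.I)
  let Y : Ω → ℂ := fun ω ↦ Complex.exp (θ * (B (s + h) ω - B s ω) * Complex.I)
  have hXp : Measurable[pastSigma B s] X := by
    refine Measurable.indicator ?_ hG
    have := measurable_pastSigma B (le_refl s)
    have h3 : Measurable (fun x : ℝ ↦ Complex.exp (θ * x * Complex.I)) := by fun_prop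
    exact h3.comp this
  have hXm : Measurable X := hXp.mono (pastSigma_le hm s) le_rfl
  have hYm : Measurable Y := by
    have h1 := hm s
    have h2 := hm (s + h)
    fun_prop
  have hI : IndepFun X Y P := by
    have h1 := (hB.indepFun_shift s).symm
    have hY : Measurable (fun w : ℝ≥0 → ℝ ↦ Complex.exp (θ * w h * Complex.I)) := by fun_prop
    have h2 := h1.comp measurable_id hY
    rw [IndepFun_iff_Indep] at h2 ⊢
    refine indep_of_indep_of_le_left ?_ hXp.comap_le
    have hYe : Y = (fun w : ℝ≥0 → ℝ ↦ Complex.exp (θ * w h * Complex.I)) ∘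
        (fun ω t ↦ B (s + t) ω - B s ω) := by
      funext ω
      simp [Y]
    rw [hYe]
    exact h2
  have key := hI.integral_fun_mul_eq_mul_integral hXm.aestronglyMeasurable hYm.aestronglyMeasurable
  have hY := integral_cexp_increment hB s h θ
  change ∫ ω, Y ω ∂P = _ at hY
  rw [hY] at key
  have hXY : (fun ω ↦ X ω * Y ω) =
      G.indicator fun ω ↦ Complex.exp (θ * B (s + h) ω * Complex.I) := by
    funext ω
    by_cases hω : ω ∈ G
    · simp only [X, Y, Set.indicator_of_mem hω, ← Complex.exp_add]
      congr 1
      ring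
    · simp [X, hω]
  rw [hXY, integral_indicator hGm, integral_indicator hGm] at key
  have hint (r : ℝ≥0) : Integrable (fun ω ↦ Complex.exp (θ * B r ω * Complex.I))
      (P.restrict G) := by
    refine Integrable.of_bound (C := 1) ?_ (ae_of_all _ fun ω ↦ ?_)
    · have := hm r
      exact Measurable.aestronglyMeasurable (by fun_prop)
    · have := Complex.norm_exp_ofReal_mul_I (θ * B r ω)
      push_cast at this
      exact this.le
  have hre (r : ℝ≥0) : (∫ ω in G, Complex.exp (θ * B r ω * Complex.I) ∂P).re =
      ∫ ω in G, Real.cos (θ * B r ω) ∂P := by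
    have h1 := integral_re (hint r)
    simp only [RCLike.re_to_complex] at h1
    rw [← h1]
    refine integral_congr_ae (ae_of_all _ fun ω ↦ ?_)
    have := Complex.exp_ofReal_mul_I_re (θ * B r ω)
    push_cast at this
    exact this
  have h4 := congrArg Complex.re key
  rw [hre, show Complex.exp (-((h : ℂ) * θ ^ 2 / 2)) =
    ((Real.exp (-(h * θ ^ 2 / 2)) : ℝ) : ℂ) by push_cast; rfl, Complex.re_mul_ofReal, hre] at h4
  rw [h4]
  ring

lemma measureReal_le_abs_increment_le (hB : IsPreBrownianReal B P) (s : ℝ≥0) {h : ℝ≥0}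
    (hh : 0 < h) {a : ℝ} (ha : 0 ≤ a) :
    P.real {ω | a ≤ |B (s + h) ω - B s ω|} ≤ 2 * Real.exp (-(a ^ 2 / (2 * h))) := by
  have : IsProbabilityMeasure P := hB.isGaussianProcess.isProbabilityMeasure
  have hl := hasLaw_increment hB s h
  have hh' : (0 : ℝ) < h := hh
  have hint (t : ℝ) : Integrable (fun ω ↦ Real.exp (t * (B (s + h) ω - B s ω))) P := by
    have := integrable_exp_mul_gaussianReal (μ := 0) (v := h) t
    rw [← hl.map_eq] at this
    exact (integrable_map_measure (by fun_prop) hl.aemeasurable).1 this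
  have hmgf (t : ℝ) : mgf (fun ω ↦ B (s + h) ω - B s ω) P t = Real.exp (h * t ^ 2 / 2) := by
    rw [mgf_gaussianReal hl.map_eq]; simp
  have h1 := measure_ge_le_exp_mul_mgf (μ := P) (X := fun ω ↦ B (s + h) ω - B s ω) a
    (t := a / h) (by positivity) (hint _)
  have h2 := measure_le_le_exp_mul_mgf (μ := P) (X := fun ω ↦ B (s + h) ω - B s ω) (-a)
    (t := -(a / h)) (by simp; positivity) (hint _)
  rw [hmgf, ← Real.exp_add] at h1 h2
  have e1 : -(a / h) * a + h * (a / h) ^ 2 / 2 = -(a ^ 2 / (2 * h)) := by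
    field_simp; ring
  have e2 : - -(a / h) * -a + h * (-(a / h)) ^ 2 / 2 = -(a ^ 2 / (2 * h)) := by
    field_simp; ring
  rw [e1] at h1
  rw [e2] at h2
  calc P.real {ω | a ≤ |B (s + h) ω - B s ω|}
      ≤ P.real ({ω | a ≤ B (s + h) ω - B s ω} ∪ {ω | B (s + h) ω - B s ω ≤ -a}) := by
        refine measureReal_mono fun ω hω ↦ ?_
        rcases le_abs.1 (show a ≤ |B (s + h) ω - B s ω| from hω) with h3 | h3
        · exact Or.inl h3
        · exact Or.inr (show B (s + h) ω - B s ω ≤ -a by linarith)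
    _ ≤ _ := measureReal_union_le _ _
    _ ≤ _ := by linarith

lemma eventually_grid {f : ℝ≥0 → ℝ} (hf : Continuous f) {s L : ℝ≥0} {b : ℝ} {r : ℝ≥0}
    (h1 : s ≤ r) (h2 : r ≤ s + L) (hr : b < |f r|) :
    ∀ᶠ n : ℕ in atTop, ∃ j ≤ n + 1, b < |f (s + j * (L / (n + 1 : ℕ)))| := by
  obtain ⟨v, rfl⟩ := exists_add_of_le h1
  have hv : v ≤ L := by simpa using h2
  rcases eq_or_ne L 0 with rfl | hL
  · obtain rfl : v = 0 := by simpa using hv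
    exact Eventually.of_forall fun n ↦ ⟨0, by simp, by simpa using hr⟩
  set u : ℝ := v / L with hu
  have hu0 : 0 ≤ u := by positivity
  have hL' : (0 : ℝ) < L := by positivity
  have hu1 : u ≤ 1 := by
    rw [hu, div_le_one hL']
    exact_mod_cast hv
  have ht : Tendsto (fun n : ℕ ↦ s + (⌊u * (n + 1 : ℕ)⌋₊ : ℝ≥0) * (L / (n + 1 : ℕ))) atTop
      (𝓝 (s + v)) := by
    rw [← NNReal.tendsto_coe]
    have h3 := (tendsto_nat_floor_mul_div_atTop hu0).comp
      ((tendsto_natCast_atTop_atTop (R := ℝ)).comp (tendsto_add_atTop_nat 1))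
    have h4 := (h3.mul_const (L : ℝ)).const_add (s : ℝ)
    convert h4 using 2
    · simp only [NNReal.coe_add, NNReal.coe_mul, NNReal.coe_div, NNReal.coe_natCast,
        Function.comp_apply]
      ring
    · push_cast
      rw [hu]
      field_simp
  have h5 := ((hf.abs.tendsto (s + v)).comp ht).eventually (lt_mem_nhds hr)
  filter_upwards [h5] with n hn
  refine ⟨_, ?_, hn⟩
  refine Nat.floor_le_of_le ?_
  exact mul_le_of_le_one_left (by positivity) hu1

/-- A path is bounded on an interval iff it is on all its uniform grids. -/
lemma forall_grid_iff {f : ℝ≥0 → ℝ} (hf : Continuous f) (s L : ℝ≥0) (b : ℝ) :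
    (∀ n : ℕ, ∀ j ≤ n + 1, |f (s + j * (L / (n + 1 : ℕ)))| ≤ b) ↔
      ∀ r, s ≤ r → r ≤ s + L → |f r| ≤ b := by
  constructor
  · intro h r h1 h2
    by_contra! hr
    obtain ⟨n, j, hj, hn⟩ := (eventually_grid hf h1 h2 hr).exists
    exact hn.not_ge (h n j hj)
  · intro h n j hj
    refine h _ (by simp) ?_
    gcongr
    rw [mul_div_left_comm]
    refine mul_le_of_le_one_right' ?_
    rw [div_le_one (by positivity)]
    exact_mod_cast hj

/-- The event that `|B|` stays below `b` on the first `k` points of a grid with mesh `h`. -/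
def gridEvent (B : ℝ≥0 → Ω → ℝ) (G : Set Ω) (s h : ℝ≥0) (b : ℝ) (k : ℕ) : Set Ω :=
  G ∩ {ω | ∀ j ≤ k, |B (s + j * h) ω| ≤ b}

omit mΩ in
lemma measurableSet_gridEvent {G : Set Ω} {s : ℝ≥0} (hG : MeasurableSet[pastSigma B s] G)
    (h : ℝ≥0) (b : ℝ) (k : ℕ) :
    MeasurableSet[pastSigma B (s + k * h)] (gridEvent B G s h b k) := by
  refine MeasurableSet.inter (pastSigma_mono B (by simp) G hG) ?_
  simp only [Set.ofPred_forall]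
  refine MeasurableSet.iInter fun j ↦ MeasurableSet.iInter fun hj ↦ ?_
  have h1 : Measurable[pastSigma B (s + k * h)] (B (s + j * h)) :=
    measurable_pastSigma B (by gcongr)
  exact h1 (measurableSet_le continuous_abs.measurable measurable_const)

lemma gridEvent_step (hB : IsPreBrownianReal B P) (hm : ∀ t, Measurable (B t))
    {G : Set Ω} {s : ℝ≥0} (hG : MeasurableSet[pastSigma B s] G) {h : ℝ≥0} (hh : 0 < h)
    {b θ σ a : ℝ} (hσ : |σ| ≤ 1) (ha : 0 ≤ a)
    (H : ∀ x y : ℝ, |x| ≤ b → b < |y| → |y - x| < a → σ * Real.cos (θ * y) ≤ 0) (k : ℕ) :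
    Real.exp (-(h * θ ^ 2 / 2)) *
        (σ * ∫ ω in gridEvent B G s h b k, Real.cos (θ * B (s + k * h) ω) ∂P)
        - 2 * Real.exp (-(a ^ 2 / (2 * h))) ≤
      σ * ∫ ω in gridEvent B G s h b (k + 1), Real.cos (θ * B (s + (k + 1 : ℕ) * h) ω) ∂P := by
  have : IsProbabilityMeasure P := hB.isGaussianProcess.isProbabilityMeasure
  set E := gridEvent B G s h b k with hE
  have hEm : MeasurableSet[pastSigma B (s + k * h)] E := measurableSet_gridEvent hG h b k
  have hEm' : MeasurableSet E := pastSigma_le hm _ _ hEm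
  have hst : s + (k + 1 : ℕ) * h = s + k * h + h := by push_cast; ring
  have h1 := setIntegral_cos_add hB hm (s + k * h) h θ hEm
  have hsub : gridEvent B G s h b (k + 1) = E ∩ {ω | |B (s + k * h + h) ω| ≤ b} := by
    ext ω
    simp only [gridEvent, hE, Set.mem_inter_iff, Set.mem_ofPred_eq, and_assoc, ← hst]
    refine and_congr_right fun _ ↦ ⟨fun h ↦ ⟨fun j hj ↦ h j (by lia), h _ le_rfl⟩, fun h j hj ↦ ?_⟩
    rcases Nat.le_succ_iff.1 hj with h' | rfl
    · exact h.1 j h'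
    · exact h.2
  rw [hsub, hst]
  set T := {ω | |B (s + k * h + h) ω| ≤ b} with hT
  have hTm : MeasurableSet T := measurableSet_le (hm _).abs measurable_const
  have hint : Integrable (fun ω ↦ Real.cos (θ * B (s + k * h + h) ω)) P := by
    refine Integrable.of_bound (C := 1) ?_ (ae_of_all _ fun ω ↦ ?_)
    · have := hm (s + k * h + h)
      exact Measurable.aestronglyMeasurable (by fun_prop)
    · exact Real.abs_cos_le_one _
  have h2 := integral_inter_add_sdiff (s := E) hTm hint.integrableOn
  have h3 : σ * ∫ ω in E \ T, Real.cos (θ * B (s + k * h + h) ω) ∂P ≤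
      2 * Real.exp (-(a ^ 2 / (2 * h))) := by
    rw [← integral_const_mul]
    refine le_trans ?_ (measureReal_le_abs_increment_le hB (s + k * h) hh ha)
    set D := {ω | a ≤ |B (s + k * h + h) ω - B (s + k * h) ω|} with hD
    have hDm : MeasurableSet D :=
      measurableSet_le measurable_const ((hm _).sub (hm _)).abs
    calc ∫ ω in E \ T, σ * Real.cos (θ * B (s + k * h + h) ω) ∂P
        ≤ ∫ ω in E \ T, D.indicator (fun _ ↦ (1 : ℝ)) ω ∂P := by
          refine setIntegral_mono_on (hint.integrableOn.const_mul σ)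
            ((integrable_const 1).indicator hDm).integrableOn (hEm'.diff hTm) fun ω hω ↦ ?_
          by_cases hd : ω ∈ D
          · rw [Set.indicator_of_mem hd]
            calc σ * Real.cos (θ * B (s + k * h + h) ω)
                ≤ |σ| * |Real.cos (θ * B (s + k * h + h) ω)| := by
                  rw [← abs_mul]; exact le_abs_self _
              _ ≤ 1 * 1 := by
                  gcongr
                  exact Real.abs_cos_le_one _
              _ = 1 := by norm_num
          · rw [Set.indicator_of_notMem hd]
            refine H (B (s + k * h) ω) _ ?_ ?_ ?_
            · exact hω.1.2 k le_rfl
            · simpa [hT] using hω.2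
            · simpa [hD] using hd
      _ ≤ ∫ ω, D.indicator (fun _ ↦ (1 : ℝ)) ω ∂P := by
          refine setIntegral_le_integral ((integrable_const 1).indicator hDm)
            (ae_of_all _ fun ω ↦ Set.indicator_nonneg (fun _ _ ↦ zero_le_one) _)
      _ = P.real D := integral_indicator_one hDm
  rw [← h2] at h1
  have h4 : Real.exp (-(h * θ ^ 2 / 2)) * (σ * ∫ ω in E, Real.cos (θ * B (s + k * h) ω) ∂P) =
      σ * (Real.exp (-(h * θ ^ 2 / 2)) * ∫ ω in E, Real.cos (θ * B (s + k * h) ω) ∂P) := by ring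
  rw [h4, ← h1, mul_add]
  linarith

lemma gridEvent_bound (hB : IsPreBrownianReal B P) (hm : ∀ t, Measurable (B t))
    {G : Set Ω} {s : ℝ≥0} (hG : MeasurableSet[pastSigma B s] G) {h : ℝ≥0} (hh : 0 < h)
    {b θ σ a : ℝ} (hσ : |σ| ≤ 1) (ha : 0 ≤ a)
    (H : ∀ x y : ℝ, |x| ≤ b → b < |y| → |y - x| < a → σ * Real.cos (θ * y) ≤ 0)
    (hGb : ∀ ω ∈ G, |B s ω| ≤ b) (k : ℕ) :
    Real.exp (-(h * θ ^ 2 / 2)) ^ k * (σ * ∫ ω in G, Real.cos (θ * B s ω) ∂P)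
        - k * (2 * Real.exp (-(a ^ 2 / (2 * h)))) ≤
      σ * ∫ ω in gridEvent B G s h b k, Real.cos (θ * B (s + k * h) ω) ∂P := by
  induction k with
  | zero =>
    have : gridEvent B G s h b 0 = G := by
      ext ω
      simp only [gridEvent, Set.mem_inter_iff, Set.mem_ofPred_eq, Nat.le_zero, forall_eq]
      simpa using hGb ω
    simp [this]
  | succ k ih =>
    have h1 := gridEvent_step hB hm hG hh hσ ha H k
    have hρ : Real.exp (-(h * θ ^ 2 / 2)) ≤ 1 := by
      rw [Real.exp_le_one_iff]; simp; positivity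
    have hρ0 := Real.exp_pos (-(h * θ ^ 2 / 2))
    set ρ := Real.exp (-(h * θ ^ 2 / 2))
    set δ := 2 * Real.exp (-(a ^ 2 / (2 * h)))
    have hδ : 0 ≤ δ := by positivity
    have h2 := mul_le_mul_of_nonneg_left ih hρ0.le
    have h3 : ρ * (k * δ) ≤ k * δ := mul_le_of_le_one_left (by positivity) hρ
    push_cast at h1 ⊢
    rw [pow_succ]
    linarith

/-- The event that `|B|` stays below `b` during `[s, s + L]`. -/
def tubeEvent (B : ℝ≥0 → Ω → ℝ) (s L : ℝ≥0) (b : ℝ) : Set Ω :=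
  {ω | ∀ r, s ≤ r → r ≤ s + L → |B r ω| ≤ b}

omit mΩ in
lemma inter_tubeEvent_eq (hc : ∀ ω, Continuous fun t ↦ B t ω) (G : Set Ω) (s L : ℝ≥0) (b : ℝ) :
    G ∩ tubeEvent B s L b = G ∩ ⋂ n : ℕ, gridEvent B Set.univ s (L / (n + 1 : ℕ)) b (n + 1) := by
  ext ω
  simp only [tubeEvent, gridEvent, Set.mem_inter_iff, Set.mem_ofPred_eq, Set.mem_iInter,
    Set.mem_univ, true_and]
  rw [forall_grid_iff (hc ω)]

omit mΩ in
lemma measurableSet_inter_tubeEvent (hc : ∀ ω, Continuous fun t ↦ B t ω) {G : Set Ω} {s : ℝ≥0}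
    (hG : MeasurableSet[pastSigma B s] G) (L : ℝ≥0) (b : ℝ) :
    MeasurableSet[pastSigma B (s + L)] (G ∩ tubeEvent B s L b) := by
  rw [inter_tubeEvent_eq hc]
  refine MeasurableSet.inter (pastSigma_mono B (by simp) G hG) (MeasurableSet.iInter fun n ↦ ?_)
  have h1 := measurableSet_gridEvent (B := B) (G := Set.univ) (s := s) MeasurableSet.univ
    (L / (n + 1 : ℕ)) b (n + 1)
  rwa [mul_div_cancel₀ _ (by positivity)] at h1

lemma tube_bound (hB : IsPreBrownianReal B P) (hm : ∀ t, Measurable (B t))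
    (hc : ∀ ω, Continuous fun t ↦ B t ω)
    {G : Set Ω} {s : ℝ≥0} (hG : MeasurableSet[pastSigma B s] G) (L : ℝ≥0)
    {b θ σ a : ℝ} (hσ : |σ| ≤ 1) (ha : 0 < a)
    (H : ∀ x y : ℝ, |x| ≤ b → b < |y| → |y - x| < a → σ * Real.cos (θ * y) ≤ 0)
    (hGb : ∀ ω ∈ G, |B s ω| ≤ b) :
    Real.exp (-(L * θ ^ 2 / 2)) * (σ * ∫ ω in G, Real.cos (θ * B s ω) ∂P) ≤
      σ * ∫ ω in G ∩ tubeEvent B s L b, Real.cos (θ * B (s + L) ω) ∂P := by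
  have : IsProbabilityMeasure P := hB.isGaussianProcess.isProbabilityMeasure
  rcases eq_or_ne L 0 with rfl | hL
  · have : G ∩ tubeEvent B s 0 b = G := by
      refine Set.inter_eq_left.2 fun ω hω r h1 h2 ↦ ?_
      obtain rfl : r = s := le_antisymm (by simpa using h2) h1
      exact hGb ω hω
    simp [this]
  have hL' : (0 : ℝ) < L := by positivity
  have hGm : MeasurableSet G := pastSigma_le hm s G hG
  have hlim : Tendsto
      (fun n : ℕ ↦ ∫ ω in gridEvent B G s (L / (n + 1 : ℕ)) b (n + 1),
        Real.cos (θ * B (s + L) ω) ∂P) atTop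
      (𝓝 (∫ ω in G ∩ tubeEvent B s L b, Real.cos (θ * B (s + L) ω) ∂P)) := by
    have hgm (n : ℕ) : MeasurableSet (gridEvent B G s (L / (n + 1 : ℕ)) b (n + 1)) :=
      pastSigma_le hm _ _ (measurableSet_gridEvent hG _ _ _)
    have htm : MeasurableSet (G ∩ tubeEvent B s L b) :=
      pastSigma_le hm _ _ (measurableSet_inter_tubeEvent hc hG L b)
    simp_rw [← integral_indicator (hgm _), ← integral_indicator htm]
    refine tendsto_integral_of_dominated_convergence (fun _ ↦ 1) (fun n ↦ ?_)
      (integrable_const 1) (fun n ↦ ae_of_all _ fun ω ↦ ?_) (ae_of_all _ fun ω ↦ ?_)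
    · have := hm (s + L)
      exact (Measurable.indicator (by fun_prop) (hgm n)).aestronglyMeasurable
    · refine (norm_indicator_le_norm_self _ _).trans ?_
      exact Real.abs_cos_le_one _
    · refine tendsto_const_nhds.congr' ?_
      by_cases hω : ω ∈ G ∩ tubeEvent B s L b
      · refine Eventually.of_forall fun n ↦ ?_
        have h1 := (forall_grid_iff (hc ω) s L b).2 hω.2 n
        rw [Set.indicator_of_mem hω]
        exact (Set.indicator_of_mem (s := gridEvent B G s (L / (n + 1 : ℕ)) b (n + 1))
          ⟨hω.1, h1⟩ (fun ω ↦ Real.cos (θ * B (s + L) ω))).symm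
      · rw [Set.indicator_of_notMem hω]
        by_cases hωG : ω ∈ G
        · have h2 : ω ∉ tubeEvent B s L b := fun h ↦ hω ⟨hωG, h⟩
          simp only [tubeEvent, Set.mem_ofPred_eq, not_forall, not_le] at h2
          obtain ⟨r, h3, h4, h5⟩ := h2
          filter_upwards [eventually_grid (hc ω) h3 h4 h5] with n hn
          obtain ⟨j, hj, hj'⟩ := hn
          exact (Set.indicator_of_notMem (s := gridEvent B G s (L / (n + 1 : ℕ)) b (n + 1))
            (fun h ↦ hj'.not_ge (h.2 j hj)) (fun ω ↦ Real.cos (θ * B (s + L) ω))).symm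
        · refine Eventually.of_forall fun n ↦ ?_
          exact (Set.indicator_of_notMem (s := gridEvent B G s (L / (n + 1 : ℕ)) b (n + 1))
            (fun h ↦ hωG h.1) (fun ω ↦ Real.cos (θ * B (s + L) ω))).symm
  have herr : Tendsto (fun n : ℕ ↦ ((n + 1 : ℕ) : ℝ) *
      (2 * Real.exp (-(a ^ 2 / (2 * ((L / (n + 1 : ℕ) : ℝ≥0) : ℝ)))))) atTop (𝓝 0) := by
    have hk : 0 < a ^ 2 / (2 * L) := by positivity
    have h1 := (Real.tendsto_pow_mul_exp_neg_atTop_nhds_zero 1).comp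
      ((tendsto_natCast_atTop_atTop (R := ℝ)).comp (tendsto_add_atTop_nat 1)
        |>.const_mul_atTop hk)
    have h2 := h1.const_mul (2 * (a ^ 2 / (2 * L))⁻¹)
    rw [mul_zero] at h2
    refine h2.congr fun n ↦ ?_
    have h3 : a ^ 2 / (2 * ((L / (n + 1 : ℕ) : ℝ≥0) : ℝ)) = a ^ 2 / (2 * L) * (n + 1 : ℕ) := by
      push_cast
      field_simp
    rw [h3]
    simp only [Function.comp_apply, pow_one]
    field_simp
  have h1 := (tendsto_const_nhds (x := Real.exp (-(L * θ ^ 2 / 2)) *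
    (σ * ∫ ω in G, Real.cos (θ * B s ω) ∂P))).sub herr
  rw [sub_zero] at h1
  refine le_of_tendsto_of_tendsto' h1 (hlim.const_mul σ) fun n ↦ ?_
  have h2 := gridEvent_bound hB hm hG (h := L / (n + 1 : ℕ)) (by positivity) hσ ha.le H hGb (n + 1)
  rw [mul_div_cancel₀ _ (by positivity), ← Real.exp_nat_mul] at h2
  have h3 : ((n + 1 : ℕ) : ℝ) * -(((L / (n + 1 : ℕ) : ℝ≥0) : ℝ) * θ ^ 2 / 2) =
      -(L * θ ^ 2 / 2) := by
    push_cast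
    field_simp
  rwa [h3] at h2

end

section

variable {Ω : Type*} [mΩ : MeasurableSpace Ω] {P : Measure Ω} {B : ℝ≥0 → Ω → ℝ}

/-- The event that `|B|` stays below `b i` up to time `c (i + 1)`, for all `i`. -/
def tubesEvent {Ω : Type*} {m : ℕ} (B : ℝ≥0 → Ω → ℝ) (c : Fin (m + 1) → ℝ≥0) (b : Fin m → ℝ) :
    Set Ω :=
  {ω | ∀ i : Fin m, ∀ r ≤ c i.succ, |B r ω| ≤ b i}

lemma abs_le_of_mem_tubesEvent {Ω : Type*} {B : ℝ≥0 → Ω → ℝ} {m : ℕ} {c : Fin (m + 1) → ℝ≥0}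
    {b : Fin m → ℝ} {ω : Ω} (hω : ω ∈ tubesEvent B c b) (hc0 : c 0 = 0) (hB0 : B 0 ω = 0) {β : ℝ}
    (hβ : 0 ≤ β) (hb : ∀ i, b i ≤ β) {r : ℝ≥0} (hr : r ≤ c (Fin.last m)) : |B r ω| ≤ β := by
  cases m with
  | zero =>
    obtain rfl : r = 0 := by
      have : r ≤ c 0 := hr
      simpa [hc0] using this
    simpa [hB0] using hβ
  | succ m => exact (hω (Fin.last m) r (by simpa using hr)).trans (hb _)

lemma tubesEvent_succ {Ω : Type*} {B : ℝ≥0 → Ω → ℝ} {m : ℕ} {c : Fin (m + 2) → ℝ≥0}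
    {b : Fin (m + 1) → ℝ} (hc0 : c 0 = 0) (hc : Monotone c) (hb0 : ∀ i, 0 ≤ b i) (hb : Monotone b)
    (hB0 : ∀ ω, B 0 ω = 0) :
    tubesEvent B c b = tubesEvent B (fun i : Fin (m + 1) ↦ c i.castSucc) (fun i ↦ b i.castSucc) ∩
      tubeEvent B (c (Fin.last m).castSucc) (c (Fin.last m).succ - c (Fin.last m).castSucc)
        (b (Fin.last m)) := by
  have hle : c (Fin.last m).castSucc ≤ c (Fin.last m).succ := hc (Fin.castSucc_le_succ _)
  ext ω
  constructor
  · intro h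
    refine ⟨fun i r hr ↦ h i.castSucc r (by simpa using hr), fun r _ hr ↦ h _ r ?_⟩
    rwa [add_tsub_cancel_of_le hle] at hr
  · rintro ⟨h1, h2⟩ i
    refine Fin.lastCases (fun r hr ↦ ?_) (fun i r hr ↦ h1 i r (by simpa using hr)) i
    rcases le_total r (c (Fin.last m).castSucc) with h3 | h3
    · exact abs_le_of_mem_tubesEvent h1 (by simpa using hc0) (hB0 ω) (hb0 _)
        (fun i ↦ hb (Fin.le_last _)) h3
    · exact h2 r h3 (by rwa [add_tsub_cancel_of_le hle])

omit mΩ in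
lemma measurableSet_tubesEvent (hcont : ∀ ω, Continuous fun t ↦ B t ω) (hB0 : ∀ ω, B 0 ω = 0)
    {m : ℕ} {c : Fin (m + 1) → ℝ≥0}
    {b : Fin m → ℝ} (hc0 : c 0 = 0) (hc : Monotone c) (hb0 : ∀ i, 0 ≤ b i) (hb : Monotone b) :
    MeasurableSet[pastSigma B (c (Fin.last m))] (tubesEvent B c b) := by
  induction m with
  | zero =>
    have : tubesEvent B c b = Set.univ := by
      ext ω; simp [tubesEvent]
    rw [this]
    exact MeasurableSet.univ
  | succ m ih =>
    rw [tubesEvent_succ hc0 hc hb0 hb hB0]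
    have h1 := ih (c := fun i : Fin (m + 1) ↦ c i.castSucc) (b := fun i ↦ b i.castSucc)
      (by simpa using hc0) (hc.comp Fin.strictMono_castSucc.monotone) (fun i ↦ hb0 _)
      (hb.comp Fin.strictMono_castSucc.monotone)
    have h2 := measurableSet_inter_tubeEvent hcont h1
      (c (Fin.last m).succ - c (Fin.last m).castSucc) (b (Fin.last m))
    rwa [add_tsub_cancel_of_le (hc (Fin.castSucc_le_succ _))] at h2

lemma integrable_cos (P : Measure Ω) [IsFiniteMeasure P] (hm : ∀ t, Measurable (B t))
    (θ : ℝ) (r : ℝ≥0) : Integrable (fun ω ↦ Real.cos (θ * B r ω)) P := by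
  refine Integrable.of_bound (C := 1) ?_ (ae_of_all _ fun ω ↦ ?_)
  · have := hm r
    exact Measurable.aestronglyMeasurable (by fun_prop)
  · exact Real.abs_cos_le_one _

lemma cos_nonpos_of_exit {b x y : ℝ} (hb : 0 < b) (hx : |x| ≤ b) (hy : b < |y|)
    (hxy : |y - x| < 2 * b) : 1 * Real.cos (Real.pi / (2 * b) * y) ≤ 0 := by
  rw [one_mul, ← Real.cos_abs, abs_mul, abs_of_pos (by positivity : 0 < Real.pi / (2 * b))]
  have h1 : |y| ≤ 3 * b := by
    have := abs_sub_abs_le_abs_sub y x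
    linarith
  have h2 : Real.pi / (2 * b) * |y| ≤ Real.pi / (2 * b) * (3 * b) := by gcongr
  have h3 : Real.pi / (2 * b) * b ≤ Real.pi / (2 * b) * |y| := by gcongr
  have e2 : Real.pi / (2 * b) * (3 * b) = Real.pi + Real.pi / 2 := by field_simp; ring
  have e3 : Real.pi / (2 * b) * b = Real.pi / 2 := by field_simp
  exact Real.cos_nonpos_of_pi_div_two_le_of_le (by linarith) (by linarith)

lemma exp_le_setIntegral_cos_tubesEvent (hB : IsPreBrownianReal B P)
    (hm : ∀ t, Measurable (B t)) (hcont : ∀ ω, Continuous fun t ↦ B t ω) (hB0 : ∀ ω, B 0 ω = 0)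
    {m : ℕ} {c : Fin (m + 1) → ℝ≥0} {b : Fin m → ℝ} (hc0 : c 0 = 0) (hc : Monotone c)
    (hb0 : ∀ i, 0 < b i) (hb : Monotone b) {θ : ℝ} (hθ0 : 0 ≤ θ)
    (hθ : ∀ i, θ ≤ Real.pi / (2 * b i)) :
    Real.exp (-∑ i : Fin m, (c i.succ - c i.castSucc : ℝ) * (Real.pi / (2 * b i)) ^ 2 / 2) ≤
      ∫ ω in tubesEvent B c b, Real.cos (θ * B (c (Fin.last m)) ω) ∂P := by
  have : IsProbabilityMeasure P := hB.isGaussianProcess.isProbabilityMeasure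
  induction m generalizing θ with
  | zero =>
    have : tubesEvent B c b = Set.univ := by
      ext ω; simp [tubesEvent]
    simp [this, hc0, hB0]
  | succ m ih =>
    have hle : c (Fin.last m).castSucc ≤ c (Fin.last m).succ := hc (Fin.castSucc_le_succ _)
    have hbm := hb.comp (Fin.strictMono_castSucc (n := m)).monotone
    have hcm := hc.comp (Fin.strictMono_castSucc (n := m + 1)).monotone
    have hE := measurableSet_tubesEvent (b := b) hcont hB0 hc0 hc (fun i ↦ (hb0 i).le) hb
    have h1 := ih (c := fun i : Fin (m + 1) ↦ c i.castSucc) (b := fun i ↦ b i.castSucc)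
      (by simpa using hc0) hcm (fun i ↦ hb0 _) hbm
      (θ := Real.pi / (2 * b (Fin.last m))) (by have := hb0 (Fin.last m); positivity) (fun i ↦ by
        have := hb0 i.castSucc
        have := hb (Fin.le_last i.castSucc)
        gcongr)
    have hG := measurableSet_tubesEvent (c := fun i : Fin (m + 1) ↦ c i.castSucc)
      (b := fun i : Fin m ↦ b i.castSucc) hcont hB0
      (by simpa using hc0) hcm (fun i ↦ (hb0 _).le) hbm
    have h2 := tube_bound hB hm hcont hG (c (Fin.last m).succ - c (Fin.last m).castSucc)
      (b := b (Fin.last m)) (θ := Real.pi / (2 * b (Fin.last m))) (σ := 1)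
      (a := 2 * b (Fin.last m)) (by simp) (by have := hb0 (Fin.last m); positivity)
      (fun x y hx hy hxy ↦ cos_nonpos_of_exit (hb0 _) hx hy hxy)
      (fun ω hω ↦ abs_le_of_mem_tubesEvent hω (by simpa using hc0) (hB0 ω) (hb0 _).le
        (fun i ↦ hb (Fin.le_last _)) le_rfl)
    rw [add_tsub_cancel_of_le hle, one_mul, one_mul, ← tubesEvent_succ hc0 hc
      (fun i ↦ (hb0 i).le) hb hB0, NNReal.coe_sub hle] at h2
    rw [Fin.sum_univ_castSucc, neg_add, Real.exp_add, mul_comm]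
    calc _ ≤ _ := mul_le_mul_of_nonneg_left h1 (Real.exp_pos _).le
      _ ≤ _ := h2
      _ ≤ _ := by
        refine setIntegral_mono_on (integrable_cos P hm _ _).integrableOn
          (integrable_cos P hm _ _).integrableOn (pastSigma_le hm _ _ hE) fun ω hω ↦ ?_
        have h3 : |B (c (Fin.last m).succ) ω| ≤ b (Fin.last m) := hω _ _ le_rfl
        have hbl := hb0 (Fin.last m)
        change Real.cos _ ≤ Real.cos (θ * B (c (Fin.last m).succ) ω)
        rw [← Real.cos_abs, ← Real.cos_abs (θ * _), abs_mul, abs_mul, abs_of_nonneg hθ0,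
          abs_of_pos (by positivity : 0 < Real.pi / (2 * b (Fin.last m)))]
        refine Real.cos_le_cos_of_nonneg_of_le_pi (by positivity) ?_ (by gcongr; exact hθ _)
        calc Real.pi / (2 * b (Fin.last m)) * |B (c (Fin.last m).succ) ω|
            ≤ Real.pi / (2 * b (Fin.last m)) * b (Fin.last m) := by gcongr
          _ = Real.pi / 2 := by field_simp
          _ ≤ Real.pi := by linarith [Real.pi_pos]

/-- Lower bound for the probability that Brownian motion stays in a widening tube. -/
lemma exp_le_measureReal_tubesEvent (hB : IsPreBrownianReal B P)
    (hm : ∀ t, Measurable (B t)) (hcont : ∀ ω, Continuous fun t ↦ B t ω) (hB0 : ∀ ω, B 0 ω = 0)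
    {m : ℕ} {c : Fin (m + 1) → ℝ≥0} {b : Fin m → ℝ} (hc0 : c 0 = 0) (hc : Monotone c)
    (hb0 : ∀ i, 0 < b i) (hb : Monotone b) :
    Real.exp (-∑ i : Fin m, (c i.succ - c i.castSucc : ℝ) * (Real.pi / (2 * b i)) ^ 2 / 2) ≤
      P.real (tubesEvent B c b) := by
  have h1 := exp_le_setIntegral_cos_tubesEvent hB hm hcont hB0 hc0 hc hb0 hb le_rfl
    (fun i ↦ by have := hb0 i; positivity)
  simpa using h1

lemma neg_cos_nonpos_of_exit {b q x y : ℝ} (hb : 0 < b) (hq0 : 0 < q) (hx : |x| ≤ b)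
    (hxy : |y - x| < (q⁻¹ - 1) * b) : -1 * Real.cos (q * (Real.pi / (2 * b)) * y) ≤ 0 := by
  have h1 : |y| ≤ q⁻¹ * b := by
    have := abs_sub_abs_le_abs_sub y x
    linarith
  have h2 : |q * (Real.pi / (2 * b)) * y| ≤ Real.pi / 2 := by
    rw [abs_mul, abs_of_pos (by positivity : 0 < q * (Real.pi / (2 * b)))]
    calc q * (Real.pi / (2 * b)) * |y| ≤ q * (Real.pi / (2 * b)) * (q⁻¹ * b) := by gcongr
      _ = Real.pi / 2 := by field_simp
  have := Real.cos_nonneg_of_neg_pi_div_two_le_of_le (abs_le.1 h2).1 (abs_le.1 h2).2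
  linarith

lemma cos_mul_pi_div_two_pos {q : ℝ} (hq0 : 0 < q) (hq : q < 1) :
    0 < Real.cos (q * (Real.pi / 2)) :=
  Real.cos_pos_of_mem_Ioo ⟨by have := Real.pi_pos; nlinarith, by
    have := Real.pi_pos; nlinarith⟩

lemma setIntegral_cos_tubesEvent_le (hB : IsPreBrownianReal B P)
    (hm : ∀ t, Measurable (B t)) (hcont : ∀ ω, Continuous fun t ↦ B t ω) (hB0 : ∀ ω, B 0 ω = 0)
    {m : ℕ} {c : Fin (m + 1) → ℝ≥0} {b : Fin m → ℝ} (hc0 : c 0 = 0) (hc : Monotone c)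
    (hb0 : ∀ i, 0 < b i) (hb : Monotone b) {q : ℝ} (hq0 : 0 < q) (hq : q < 1) (θ : ℝ) :
    ∫ ω in tubesEvent B c b, Real.cos (θ * B (c (Fin.last m)) ω) ∂P ≤
      (Real.cos (q * (Real.pi / 2)))⁻¹ ^ m *
      Real.exp (-∑ i : Fin m,
        (c i.succ - c i.castSucc : ℝ) * (q * (Real.pi / (2 * b i))) ^ 2 / 2) := by
  have : IsProbabilityMeasure P := hB.isGaussianProcess.isProbabilityMeasure
  induction m generalizing θ with
  | zero =>
    have : tubesEvent B c b = Set.univ := by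
      ext ω; simp [tubesEvent]
    simp [this, hc0, hB0]
  | succ m ih =>
    have hle : c (Fin.last m).castSucc ≤ c (Fin.last m).succ := hc (Fin.castSucc_le_succ _)
    have hbm := hb.comp (Fin.strictMono_castSucc (n := m)).monotone
    have hcm := hc.comp (Fin.strictMono_castSucc (n := m + 1)).monotone
    have hE := measurableSet_tubesEvent (b := b) hcont hB0 hc0 hc (fun i ↦ (hb0 i).le) hb
    have hbl := hb0 (Fin.last m)
    have h1 := ih (c := fun i : Fin (m + 1) ↦ c i.castSucc) (b := fun i ↦ b i.castSucc)
      (by simpa using hc0) hcm (fun i ↦ hb0 _) hbm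
      (θ := q * (Real.pi / (2 * b (Fin.last m))))
    have hG := measurableSet_tubesEvent (c := fun i : Fin (m + 1) ↦ c i.castSucc)
      (b := fun i : Fin m ↦ b i.castSucc) hcont hB0
      (by simpa using hc0) hcm (fun i ↦ (hb0 _).le) hbm
    have h2 := tube_bound hB hm hcont hG (c (Fin.last m).succ - c (Fin.last m).castSucc)
      (b := b (Fin.last m)) (θ := q * (Real.pi / (2 * b (Fin.last m)))) (σ := -1)
      (a := (q⁻¹ - 1) * b (Fin.last m)) (by simp)
      (mul_pos (sub_pos.2 ((one_lt_inv₀ hq0).2 hq)) hbl)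
      (fun x y hx hy hxy ↦ neg_cos_nonpos_of_exit hbl hq0 hx hxy)
      (fun ω hω ↦ abs_le_of_mem_tubesEvent hω (by simpa using hc0) (hB0 ω) (hb0 _).le
        (fun i ↦ hb (Fin.le_last _)) le_rfl)
    rw [add_tsub_cancel_of_le hle, ← tubesEvent_succ hc0 hc
      (fun i ↦ (hb0 i).le) hb hB0, NNReal.coe_sub hle] at h2
    rw [Fin.sum_univ_castSucc, neg_add, Real.exp_add, pow_succ]
    have hκ := cos_mul_pi_div_two_pos hq0 hq
    set κ := Real.cos (q * (Real.pi / 2))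
    calc ∫ ω in tubesEvent B c b, Real.cos (θ * B (c (Fin.last (m + 1))) ω) ∂P
        ≤ ∫ ω in tubesEvent B c b, κ⁻¹ *
            Real.cos (q * (Real.pi / (2 * b (Fin.last m))) * B (c (Fin.last m).succ) ω) ∂P := by
          refine setIntegral_mono_on (integrable_cos P hm _ _).integrableOn
            ((integrable_cos P hm _ _).const_mul _).integrableOn (pastSigma_le hm _ _ hE)
            fun ω hω ↦ ?_
          have h3 : |B (c (Fin.last m).succ) ω| ≤ b (Fin.last m) := hω _ _ le_rfl
          refine (Real.cos_le_one _).trans ?_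
          rw [inv_mul_eq_div, one_le_div hκ, ← Real.cos_abs (_ * B _ _), abs_mul,
            abs_of_pos (by positivity : 0 < q * (Real.pi / (2 * b (Fin.last m))))]
          refine Real.cos_le_cos_of_nonneg_of_le_pi (by positivity) ?_ ?_
          · have := Real.pi_pos; nlinarith
          · calc q * (Real.pi / (2 * b (Fin.last m))) * |B (c (Fin.last m).succ) ω|
                ≤ q * (Real.pi / (2 * b (Fin.last m))) * b (Fin.last m) := by gcongr
              _ = q * (Real.pi / 2) := by field_simp
      _ = κ⁻¹ * ∫ ω in tubesEvent B c b,
            Real.cos (q * (Real.pi / (2 * b (Fin.last m))) * B (c (Fin.last m).succ) ω) ∂P :=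
          integral_const_mul _ _
      _ ≤ κ⁻¹ * (Real.exp (-((c (Fin.last m).succ - c (Fin.last m).castSucc : ℝ) *
            (q * (Real.pi / (2 * b (Fin.last m)))) ^ 2 / 2)) * (κ⁻¹ ^ m *
              Real.exp (-∑ i : Fin m, (c i.castSucc.succ - c i.castSucc.castSucc : ℝ) *
                (q * (Real.pi / (2 * b i.castSucc))) ^ 2 / 2))) := by
          gcongr
          have h4 := mul_le_mul_of_nonneg_left h1 (Real.exp_pos
            (-((c (Fin.last m).succ - c (Fin.last m).castSucc : ℝ) *
            (q * (Real.pi / (2 * b (Fin.last m)))) ^ 2 / 2))).le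
          simp only [Fin.succ_castSucc]
          refine le_trans ?_ h4
          linarith
      _ = _ := by ring

/-- Upper bound for the probability that Brownian motion stays in a widening tube. -/
lemma measureReal_tubesEvent_le (hB : IsPreBrownianReal B P)
    (hm : ∀ t, Measurable (B t)) (hcont : ∀ ω, Continuous fun t ↦ B t ω) (hB0 : ∀ ω, B 0 ω = 0)
    {m : ℕ} {c : Fin (m + 1) → ℝ≥0} {b : Fin m → ℝ} (hc0 : c 0 = 0) (hc : Monotone c)
    (hb0 : ∀ i, 0 < b i) (hb : Monotone b) {q : ℝ} (hq0 : 0 < q) (hq : q < 1) :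
    P.real (tubesEvent B c b) ≤
      (Real.cos (q * (Real.pi / 2)))⁻¹ ^ m *
      Real.exp (-∑ i : Fin m,
        (c i.succ - c i.castSucc : ℝ) * (q * (Real.pi / (2 * b i))) ^ 2 / 2) := by
  simpa using setIntegral_cos_tubesEvent_le hB hm hcont hB0 hc0 hc hb0 hb hq0 hq 0

end

section Rates

variable {ι : Type*} {l : Filter ι} {p p' r : ι → ℝ} {a c c' : ℝ}

/-- `p` is at most `exp (-(c + o(1)) r)`. -/
def UpperRate (l : Filter ι) (p r : ι → ℝ) (c : ℝ) : Prop :=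
  ∀ c' < c, ∀ᶠ x in l, p x ≤ Real.exp (-(c' * r x))

/-- `p` is at least `exp (-(c + o(1)) r)`. -/
def LowerRate (l : Filter ι) (p r : ι → ℝ) (c : ℝ) : Prop :=
  ∀ c' > c, ∀ᶠ x in l, Real.exp (-(c' * r x)) ≤ p x

lemma UpperRate.mono (h : UpperRate l p r c) (hc : c' ≤ c) : UpperRate l p r c' :=
  fun _ h' ↦ h _ (h'.trans_le hc)

lemma UpperRate.of_le (h : UpperRate l p r c) (hp : ∀ᶠ x in l, p' x ≤ p x) :
    UpperRate l p' r c := fun c' h' ↦ by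
  filter_upwards [h c' h', hp] with x h1 h2 using h2.trans h1

lemma LowerRate.of_le (h : LowerRate l p r c) (hp : ∀ᶠ x in l, p x ≤ p' x) :
    LowerRate l p' r c := fun c' h' ↦ by
  filter_upwards [h c' h', hp] with x h1 h2 using h1.trans h2

lemma UpperRate.of_forall_lt (h : ∀ c' < c, UpperRate l p r c') : UpperRate l p r c :=
  fun c' hc' ↦ by
    obtain ⟨d, hd1, hd2⟩ := exists_between hc'
    exact h d hd2 c' hd1

lemma UpperRate.exp_mul (h : UpperRate l p r c) (a : ℝ) :
    UpperRate l (fun x ↦ Real.exp (-(a * r x)) * p x) r (a + c) := fun c' h' ↦ by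
  filter_upwards [h (c' - a) (by linarith)] with x h1
  calc Real.exp (-(a * r x)) * p x ≤ Real.exp (-(a * r x)) * Real.exp (-((c' - a) * r x)) := by
        gcongr
    _ = Real.exp (-(c' * r x)) := by rw [← Real.exp_add]; ring_nf

lemma LowerRate.exp_mul (h : LowerRate l p r c) (a : ℝ) :
    LowerRate l (fun x ↦ Real.exp (-(a * r x)) * p x) r (a + c) := fun c' h' ↦ by
  filter_upwards [h (c' - a) (by linarith)] with x h1
  calc Real.exp (-(c' * r x)) = Real.exp (-(a * r x)) * Real.exp (-((c' - a) * r x)) := by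
        rw [← Real.exp_add]; ring_nf
    _ ≤ Real.exp (-(a * r x)) * p x := by gcongr

lemma upperRate_exp (hr : Tendsto r l atTop) (a : ℝ) :
    UpperRate l (fun x ↦ Real.exp (-(a * r x))) r a := fun c' h' ↦ by
  filter_upwards [hr.eventually_ge_atTop 0] with x h1
  gcongr

lemma UpperRate.const_mul (hr : Tendsto r l atTop) (h : UpperRate l p r c) {C : ℝ} (hC : 0 < C) :
    UpperRate l (fun x ↦ C * p x) r c := fun c' h' ↦ by
  obtain ⟨d, hd1, hd2⟩ := exists_between h'
  have h1 : Tendsto (fun x ↦ (d - c') * r x) l atTop := hr.const_mul_atTop (by linarith)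
  filter_upwards [h d hd2, h1.eventually_ge_atTop (Real.log C)] with x h2 h3
  calc C * p x ≤ Real.exp (Real.log C) * Real.exp (-(d * r x)) := by
        rw [Real.exp_log hC]; gcongr
    _ = Real.exp (Real.log C + -(d * r x)) := (Real.exp_add _ _).symm
    _ ≤ Real.exp (-(c' * r x)) := by
        refine Real.exp_le_exp.2 ?_
        linarith

lemma UpperRate.sum (hr : Tendsto r l atTop) {κ : Type*} (s : Finset κ) {q : κ → ι → ℝ}
    (h : ∀ j ∈ s, UpperRate l (q j) r c) : UpperRate l (fun x ↦ ∑ j ∈ s, q j x) r c := by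
  intro c' h'
  obtain ⟨d, hd1, hd2⟩ := exists_between h'
  have h1 := (upperRate_exp hr d).const_mul hr (C := s.card + 1) (by positivity) c' hd1
  have h2 : ∀ᶠ x in l, ∀ j ∈ s, q j x ≤ Real.exp (-(d * r x)) :=
    (Finset.eventually_all s).2 fun j hj ↦ h j hj d hd2
  filter_upwards [h1, h2] with x h3 h4
  refine le_trans ?_ h3
  refine (Finset.sum_le_card_nsmul s _ _ h4).trans ?_
  rw [nsmul_eq_mul]
  gcongr
  linarith

lemma UpperRate.add (hr : Tendsto r l atTop) (h : UpperRate l p r c) (h' : UpperRate l p' r c) :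
    UpperRate l (fun x ↦ p x + p' x) r c := by
  have := UpperRate.sum hr Finset.univ (q := fun b : Bool ↦ if b then p else p') (c := c)
    (by intro j _; cases j <;> simpa)
  simpa using this

lemma LowerRate.sub (hr : Tendsto r l atTop) (h : LowerRate l p r c) (h' : UpperRate l p' r c')
    (hc : c < c') : LowerRate l (fun x ↦ p x - p' x) r c := by
  intro d hd
  obtain ⟨e, he1, he2⟩ := exists_between (lt_min hd hc)
  obtain ⟨f, hf1, hf2⟩ := exists_between he2
  filter_upwards [h e he1, h' f (hf2.trans_le (min_le_right _ _)),
    (upperRate_exp hr f).const_mul hr two_pos e hf1, hr.eventually_ge_atTop 0] with x h1 h2 h3 h4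
  have h5 : Real.exp (-(d * r x)) ≤ Real.exp (-(f * r x)) := by
    have := hf2.trans_le (min_le_left _ _)
    gcongr
  linarith

lemma tendsto_of_rates (hr : Tendsto r l atTop) (hu : UpperRate l p r c)
    (hl : LowerRate l p r c) :
    Tendsto (fun x ↦ (r x)⁻¹ * Real.log (p x)) l (𝓝 (-c)) := by
  rw [tendsto_order]
  constructor
  · intro a ha
    obtain ⟨d, hd1, hd2⟩ := exists_between ha
    filter_upwards [hl (-d) (by linarith), hr.eventually_gt_atTop 0] with x h1 h2
    have h3 := Real.log_le_log (Real.exp_pos _) h1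
    rw [Real.log_exp] at h3
    refine hd1.trans_le ?_
    rw [inv_mul_eq_div, le_div_iff₀ h2]
    linarith
  · intro a ha
    obtain ⟨d, hd1, hd2⟩ := exists_between ha
    filter_upwards [hl (c + 1) (by linarith), hu (-d) (by linarith),
      hr.eventually_gt_atTop 0] with x h0 h1 h2
    have h3 := Real.log_le_log ((Real.exp_pos _).trans_le h0) h1
    rw [Real.log_exp] at h3
    refine lt_of_le_of_lt ?_ hd2
    rw [inv_mul_eq_div, div_le_iff₀ h2]
    linarith

lemma upperRate_of_tendsto (hr : Tendsto r l atTop) (hp : ∀ᶠ x in l, 0 < p x)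
    (h : Tendsto (fun x ↦ (r x)⁻¹ * Real.log (p x)) l (𝓝 (-c))) : UpperRate l p r c := by
  intro c' hc'
  filter_upwards [hp, hr.eventually_gt_atTop 0, h.eventually_lt_const (neg_lt_neg hc')]
    with x h1 h2 h3
  rw [← Real.log_le_iff_le_exp h1]
  rw [inv_mul_eq_div, div_lt_iff₀ h2] at h3
  linarith

lemma lowerRate_of_tendsto (hr : Tendsto r l atTop) (hp : ∀ᶠ x in l, 0 < p x)
    (h : Tendsto (fun x ↦ (r x)⁻¹ * Real.log (p x)) l (𝓝 (-c))) : LowerRate l p r c := by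
  intro c' hc'
  filter_upwards [hp, hr.eventually_gt_atTop 0, h.eventually_const_lt (neg_lt_neg hc')]
    with x h1 h2 h3
  rw [← Real.le_log_iff_exp_le h1]
  rw [inv_mul_eq_div, lt_div_iff₀ h2] at h3
  linarith

end Rates

section Tauberian

variable {Ω : Type*} [mΩ : MeasurableSpace Ω] {P : Measure Ω} [IsProbabilityMeasure P]
  {S : Ω → ℝ} {ι : Type*} {l : Filter ι} {r s lam : ι → ℝ} {α κ A c : ℝ}

lemma integrable_exp_neg_mul (hS : Measurable S) (hS0 : ∀ ω, 0 ≤ S ω) {μ : ℝ} (hμ : 0 ≤ μ) :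
    Integrable (fun ω ↦ Real.exp (-(μ * S ω))) P := by
  refine Integrable.of_bound (C := 1) (by fun_prop) (ae_of_all _ fun ω ↦ ?_)
  rw [Real.norm_eq_abs, Real.abs_exp, Real.exp_le_one_iff]
  have := mul_nonneg hμ (hS0 ω)
  linarith

lemma exp_mul_le_laplace (hS : Measurable S) (hS0 : ∀ ω, 0 ≤ S ω) {μ : ℝ} (hμ : 0 ≤ μ) (u : ℝ) :
    Real.exp (-(μ * u)) * P.real {ω | S ω ≤ u} ≤ ∫ ω, Real.exp (-(μ * S ω)) ∂P := by
  have hm : MeasurableSet {ω | S ω ≤ u} := measurableSet_le hS measurable_const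
  rw [mul_comm, ← smul_eq_mul, ← integral_indicator_const _ hm]
  refine integral_mono ((integrable_const _).indicator hm) (integrable_exp_neg_mul hS hS0 hμ)
    fun ω ↦ ?_
  by_cases hω : S ω ≤ u
  · rw [Set.indicator_of_mem (by exact hω)]
    gcongr
  · rw [Set.indicator_of_notMem (by exact hω)]
    exact (Real.exp_pos _).le

lemma laplace_le_sum (hS : Measurable S) (hS0 : ∀ ω, 0 ≤ S ω) {μ : ℝ} (hμ : 0 ≤ μ) (u : ℝ)
    (N : ℕ) :
    ∫ ω, Real.exp (-(μ * S ω)) ∂P ≤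
      ∑ j ∈ Finset.range N, Real.exp (-(μ * (j * u))) * P.real {ω | S ω ≤ (j + 1) * u} +
        Real.exp (-(μ * (N * u))) := by
  have hm (j : ℕ) : MeasurableSet {ω | S ω ≤ (j + 1) * u} := measurableSet_le hS measurable_const
  have hi (j : ℕ) : Integrable ({ω | S ω ≤ (j + 1) * u}.indicator
      fun _ ↦ Real.exp (-(μ * (j * u)))) P := (integrable_const _).indicator (hm j)
  calc ∫ ω, Real.exp (-(μ * S ω)) ∂P
      ≤ ∫ ω, (∑ j ∈ Finset.range N, {ω | S ω ≤ (j + 1) * u}.indicator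
          (fun _ ↦ Real.exp (-(μ * (j * u)))) ω + Real.exp (-(μ * (N * u)))) ∂P := by
        refine integral_mono (integrable_exp_neg_mul hS hS0 hμ)
          ((integrable_finsetSum _ fun j _ ↦ hi j).add (integrable_const _)) fun ω ↦ ?_
        have hnn (j : ℕ) : 0 ≤ {ω | S ω ≤ (j + 1) * u}.indicator
            (fun _ ↦ Real.exp (-(μ * (j * u)))) ω :=
          Set.indicator_nonneg (fun _ _ ↦ (Real.exp_pos _).le) _
        by_cases h : ∃ j < N, S ω ≤ (j + 1) * u
        · classical
          obtain ⟨hj1, hj2⟩ := Nat.find_spec h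
          set j := Nat.find h with hj
          have h1 : j * u ≤ S ω := by
            rcases Nat.eq_zero_or_pos j with h0 | h0
            · simpa [h0] using hS0 ω
            · have := Nat.find_min h (m := j - 1) (by lia)
              push Not at this
              have := this (by lia)
              rw [Nat.cast_sub (by lia)] at this
              push_cast at this
              nlinarith
          refine le_add_of_le_of_nonneg ?_ (Real.exp_pos _).le
          refine le_trans ?_ (Finset.single_le_sum (fun j _ ↦ hnn j) (Finset.mem_range.2 hj1))
          rw [Set.indicator_of_mem (by exact hj2)]
          gcongr
        · push Not at h
          refine le_add_of_nonneg_of_le (Finset.sum_nonneg fun j _ ↦ hnn j) ?_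
          have h1 : N * u ≤ S ω := by
            rcases Nat.eq_zero_or_pos N with h0 | h0
            · simpa [h0] using hS0 ω
            · have := h (N - 1) (by lia)
              rw [Nat.cast_sub (by lia)] at this
              push_cast at this
              nlinarith
          gcongr
    _ = _ := by
        rw [integral_add (integrable_finsetSum _ fun j _ ↦ hi j) (integrable_const _),
          integral_finsetSum _ fun j _ ↦ hi j]
        simp only [integral_const, probReal_univ, smul_eq_mul, one_mul]
        congr 1
        refine Finset.sum_congr rfl fun j _ ↦ ?_
        rw [integral_indicator_const _ (hm j), smul_eq_mul, mul_comm]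

lemma lowerRate_laplace (hS : Measurable S) (hS0 : ∀ ω, 0 ≤ S ω)
    (hlam : ∀ᶠ x in l, 0 ≤ lam x) (hls : ∀ᶠ x in l, lam x * s x = A * r x) {x : ℝ}
    (h : LowerRate l (fun y ↦ P.real {ω | S ω ≤ x * s y}) r c) :
    LowerRate l (fun y ↦ ∫ ω, Real.exp (-(lam y * S ω)) ∂P) r (A * x + c) := by
  refine (h.exp_mul (A * x)).of_le ?_
  filter_upwards [hlam, hls] with y h1 h2
  have h3 := exp_mul_le_laplace (P := P) hS hS0 h1 (x * s y)
  rwa [show lam y * (x * s y) = A * x * r y by rw [mul_left_comm, h2]; ring] at h3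

lemma upperRate_laplace (hr : Tendsto r l atTop) (hS : Measurable S) (hS0 : ∀ ω, 0 ≤ S ω)
    (hlam : ∀ᶠ x in l, 0 ≤ lam x)
    (hls : ∀ᶠ x in l, lam x * s x = A * r x) (hA : 0 < A) {φ : ℝ → ℝ}
    (h : ∀ x > 0, UpperRate l (fun y ↦ P.real {ω | S ω ≤ x * s y}) r (φ x))
    (hc : ∀ x > 0, c ≤ A * x + φ x) :
    UpperRate l (fun y ↦ ∫ ω, Real.exp (-(lam y * S ω)) ∂P) r c := by
  refine UpperRate.of_forall_lt fun c' hc' ↦ ?_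
  set h0 := (c - c') / A with hh0
  have hh : 0 < h0 := div_pos (by linarith) hA
  obtain ⟨N, hN⟩ := exists_nat_ge (c' / (A * h0))
  rw [div_le_iff₀ (by positivity)] at hN
  have h1 : UpperRate l (fun y ↦ ∑ j ∈ Finset.range N, Real.exp (-((A * (j * h0)) * r y)) *
      P.real {ω | S ω ≤ ((j + 1) * h0) * s y} + Real.exp (-((A * (N * h0)) * r y))) r c' := by
    refine UpperRate.add hr (UpperRate.sum hr _ fun j _ ↦ ?_)
      ((upperRate_exp hr _).mono (by linarith))
    refine ((h ((j + 1) * h0) (by positivity)).exp_mul _).mono ?_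
    have h2 := hc ((j + 1) * h0) (by positivity)
    have h3 : A * h0 = c - c' := by rw [hh0]; field_simp
    linarith
  refine h1.of_le ?_
  filter_upwards [hlam, hls] with y h2 h4
  have h5 := laplace_le_sum (P := P) hS hS0 h2 (h0 * s y) N
  have e (v : ℝ) : lam y * (v * (h0 * s y)) = A * (v * h0) * r y := by
    linear_combination v * h0 * h4
  simp only [e] at h5
  simpa only [mul_assoc] using h5

end Tauberian

section Scales

lemma tendsto_neg_log_nhdsGT_zero : Tendsto (fun ε : ℝ ↦ -Real.log ε) (𝓝[>] 0) atTop :=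
  tendsto_neg_atBot_atTop.comp Real.tendsto_log_nhdsGT_zero

lemma eventually_small :
    ∀ᶠ ε : ℝ in 𝓝[>] 0, 0 < ε ∧ 0 < -Real.log ε ∧ |Real.log ε| = -Real.log ε := by
  filter_upwards [self_mem_nhdsWithin, tendsto_neg_log_nhdsGT_zero.eventually_gt_atTop 0]
    with ε h1 h2
  exact ⟨h1, h2, abs_of_neg (by linarith)⟩

lemma tendsto_log_scale_div_log (x p q : ℝ) (hx : 0 < x) :
    Tendsto (fun ε : ℝ ↦ Real.log (x * (ε ^ p * |Real.log ε| ^ q)) / (-Real.log ε)) (𝓝[>] 0)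
      (𝓝 (-p)) := by
  have h1 : Tendsto (fun ε : ℝ ↦ Real.log x * (-Real.log ε)⁻¹ - p +
      q * (Real.log (-Real.log ε) / (-Real.log ε))) (𝓝[>] 0) (𝓝 (Real.log x * 0 - p + q * 0)) := by
    refine ((tendsto_neg_log_nhdsGT_zero.inv_tendsto_atTop.const_mul _).sub_const _).add
      (Tendsto.const_mul _ ?_)
    have := Real.isLittleO_log_id_atTop.tendsto_div_nhds_zero
    exact this.comp tendsto_neg_log_nhdsGT_zero
  simp only [mul_zero, zero_sub, add_zero] at h1
  refine h1.congr' ?_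
  filter_upwards [eventually_small] with ε ⟨h2, h3, h4⟩
  rw [h4, Real.log_mul hx.ne' (by positivity), Real.log_mul (by positivity) (by positivity),
    Real.log_rpow h2, Real.log_rpow h3]
  have h5 : Real.log ε ≠ 0 := (neg_pos.1 h3).ne
  field_simp
  ring

lemma scale_pos (x p q : ℝ) (hx : 0 < x) :
    ∀ᶠ ε : ℝ in 𝓝[>] 0, 0 < x * (ε ^ p * |Real.log ε| ^ q) := by
  filter_upwards [eventually_small] with ε ⟨h2, h3, h4⟩
  rw [h4]
  positivity

lemma tendsto_scale_zero (x : ℝ) {p : ℝ} (q : ℝ) (hx : 0 < x) (hp : 0 < p) :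
    Tendsto (fun ε : ℝ ↦ x * (ε ^ p * |Real.log ε| ^ q)) (𝓝[>] 0) (𝓝[>] 0) := by
  refine tendsto_nhdsWithin_iff.2 ⟨?_, scale_pos x p q hx⟩
  have h1 := (tendsto_log_scale_div_log x p q hx).neg_mul_atTop (by linarith)
    tendsto_neg_log_nhdsGT_zero
  refine (Real.tendsto_exp_atBot.comp h1).congr' ?_
  filter_upwards [eventually_small, scale_pos x p q hx] with ε ⟨h2, h3, h4⟩ h5
  simp only [Function.comp_apply]
  rw [div_mul_cancel₀ _ h3.ne', Real.exp_log h5]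

lemma tendsto_scale_atTop {p : ℝ} (q : ℝ) (hp : p < 0) :
    Tendsto (fun ε : ℝ ↦ ε ^ p * |Real.log ε| ^ q) (𝓝[>] 0) atTop := by
  have h1 := (tendsto_log_scale_div_log 1 p q one_pos).pos_mul_atTop (by linarith)
    tendsto_neg_log_nhdsGT_zero
  refine (Real.tendsto_exp_atTop.comp h1).congr' ?_
  filter_upwards [eventually_small, scale_pos 1 p q one_pos] with ε ⟨h2, h3, h4⟩ h5
  simp only [Function.comp_apply]
  rw [div_mul_cancel₀ _ h3.ne', Real.exp_log h5, one_mul]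

/-- The logarithmic rate of the small-ball probabilities. -/
noncomputable def smallBallRate (α β ε : ℝ) : ℝ :=
  ε ^ (-(2 * α / (1 + α))) * |Real.log ε| ^ (-(β / (1 + α)))

/-- The scale of the clock on which the Laplace transform at `ε ^ (-2)` concentrates. -/
noncomputable def clockScale (α β ε : ℝ) : ℝ :=
  ε ^ (2 / (1 + α)) * |Real.log ε| ^ (-(β / (1 + α)))

variable {α : ℝ} (β : ℝ)

lemma tendsto_smallBallRate (hα : 0 < α) : Tendsto (smallBallRate α β) (𝓝[>] 0) atTop :=
  tendsto_scale_atTop _ (by have : 0 < 2 * α / (1 + α) := by positivity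
                            linarith)

lemma mul_clockScale (hα : 0 < α) (A : ℝ) :
    ∀ᶠ ε : ℝ in 𝓝[>] 0, A / ε ^ 2 * clockScale α β ε = A * smallBallRate α β ε := by
  filter_upwards [eventually_small] with ε ⟨h2, h3, h4⟩
  have h5 : -(2 * α / (1 + α)) = 2 / (1 + α) - (2 : ℕ) := by
    push_cast
    field_simp
    ring
  rw [clockScale, smallBallRate, h5, Real.rpow_sub_natCast h2.ne']
  field_simp

/-- The small-ball asymptotics of a random variable along the clock scale. -/
lemma tendsto_log_clockScale (hα : 0 < α) {F : ℝ → ℝ} {κ : ℝ}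
    (hF : Tendsto (fun ε : ℝ ↦ ε ^ α * |Real.log ε| ^ β * Real.log (F ε)) (𝓝[>] 0) (𝓝 (-κ)))
    {x : ℝ} (hx : 0 < x) :
    Tendsto (fun ε : ℝ ↦ (smallBallRate α β ε)⁻¹ * Real.log (F (x * clockScale α β ε))) (𝓝[>] 0)
      (𝓝 (-(κ * (2 / (1 + α)) ^ (-β) * x ^ (-α)))) := by
  have hα1 : 0 < 1 + α := by linarith
  have hs : Tendsto (fun ε ↦ x * clockScale α β ε) (𝓝[>] 0) (𝓝[>] 0) :=
    tendsto_scale_zero x _ hx (by positivity)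
  have h1 := hF.comp hs
  have h2 := tendsto_log_scale_div_log x (2 / (1 + α)) (-(β / (1 + α))) hx
  have h3 : Tendsto
      (fun ε : ℝ ↦ (-(Real.log (x * clockScale α β ε) / (-Real.log ε))) ^ (-β) * x ^ (-α))
      (𝓝[>] 0) (𝓝 ((2 / (1 + α)) ^ (-β) * x ^ (-α))) := by
    have h4 := h2.neg
    rw [neg_neg] at h4
    exact (h4.rpow_const (Or.inl (by positivity))).mul_const _
  have h5 := h1.mul h3
  rw [show -(κ * (2 / (1 + α)) ^ (-β) * x ^ (-α)) =
    -κ * ((2 / (1 + α)) ^ (-β) * x ^ (-α)) by ring]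
  refine h5.congr' ?_
  filter_upwards [eventually_small, hs.eventually eventually_small] with ε ⟨h6, h7, h8⟩
    ⟨h9, h10, h11⟩
  simp only [Function.comp_apply]
  rw [h11, ← neg_div, Real.div_rpow h10.le h7.le]
  set y := x * clockScale α β ε with hy
  have e1 : y ^ α = x ^ α * (ε ^ (2 * α / (1 + α)) * (-Real.log ε) ^ (-(α * β / (1 + α)))) := by
    rw [hy, clockScale, h8, Real.mul_rpow hx.le (by positivity),
      Real.mul_rpow (by positivity) (by positivity), ← Real.rpow_mul h6.le, ← Real.rpow_mul h7.le]
    congr 3 <;> ring_nf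
  have e2 : (smallBallRate α β ε)⁻¹ = ε ^ (2 * α / (1 + α)) * (-Real.log ε) ^ (β / (1 + α)) := by
    rw [smallBallRate, h8, mul_inv, ← Real.rpow_neg h6.le, ← Real.rpow_neg h7.le, neg_neg, neg_neg]
  have e3 : (-Real.log ε) ^ (-(α * β / (1 + α))) =
      (-Real.log ε) ^ (-β) * (-Real.log ε) ^ (β / (1 + α)) := by
    rw [← Real.rpow_add h7]
    congr 1
    field_simp
    ring
  have e4 : (-Real.log y) ^ β * (-Real.log y) ^ (-β) = 1 := by
    rw [← Real.rpow_add h10]; simp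
  have e5 : x ^ α * x ^ (-α) = 1 := by
    rw [← Real.rpow_add hx]; simp
  rw [e1, e2, e3]
  have h12 : (-Real.log ε) ^ (-β) ≠ 0 := by positivity
  field_simp
  linear_combination Real.log (F y) * (x ^ α * x ^ (-α)) * e4 + Real.log (F y) * e5

end Scales

section Optimum

/-- The minimum of `A * x + κ * x ^ (-α)` over `x > 0`. -/
lemma le_mul_add_mul_rpow {α A κ x : ℝ} (hα : 0 < α) (hA : 0 < A) (hκ : 0 < κ) (hx : 0 < x) :
    (1 + α) / α * A * (α * κ / A) ^ (1 / (1 + α)) ≤ A * x + κ * x ^ (-α) := by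
  set x₀ := (α * κ / A) ^ (1 / (1 + α)) with hx₀
  have hx₀p : 0 < x₀ := by positivity
  have h1 : κ * x₀ ^ (-α) = A * x₀ / α := by
    have h2 : x₀ ^ (1 + α) = α * κ / A := by
      rw [hx₀, ← Real.rpow_mul (by positivity), one_div_mul_cancel (by linarith), Real.rpow_one]
    rw [Real.rpow_add hx₀p, Real.rpow_one] at h2
    rw [Real.rpow_neg hx₀p.le]
    field_simp at h2 ⊢
    linarith
  have h3 : 1 - α * (x / x₀ - 1) ≤ (x / x₀) ^ (-α) := by
    rw [Real.rpow_def_of_pos (by positivity)]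
    have h4 := Real.log_le_sub_one_of_pos (show 0 < x / x₀ by positivity)
    have h5 := Real.add_one_le_exp (Real.log (x / x₀) * -α)
    nlinarith
  have h6 : κ * x ^ (-α) = A * x₀ / α * (x / x₀) ^ (-α) := by
    rw [← h1, Real.div_rpow hx.le hx₀p.le]
    field_simp
  rw [h6]
  calc (1 + α) / α * A * x₀ = A * x + A * x₀ / α * (1 - α * (x / x₀ - 1)) := by
        field_simp; ring
    _ ≤ _ := by gcongr

lemma mul_add_mul_rpow_optimum {α A κ : ℝ} (hα : 0 < α) (hA : 0 < A) (hκ : 0 < κ) :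
    A * (α * κ / A) ^ (1 / (1 + α)) + κ * ((α * κ / A) ^ (1 / (1 + α))) ^ (-α) =
      (1 + α) / α * A * (α * κ / A) ^ (1 / (1 + α)) := by
  set x₀ := (α * κ / A) ^ (1 / (1 + α)) with hx₀
  have hx₀p : 0 < x₀ := by positivity
  have h2 : x₀ ^ (1 + α) = α * κ / A := by
    rw [hx₀, ← Real.rpow_mul (by positivity), one_div_mul_cancel (by linarith), Real.rpow_one]
  rw [Real.rpow_add hx₀p, Real.rpow_one] at h2
  rw [Real.rpow_neg hx₀p.le]
  field_simp at h2 ⊢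
  linarith

end Optimum

section ExponentialTauberian

variable {Ω : Type*} [mΩ : MeasurableSpace Ω] {P : Measure Ω} [IsProbabilityMeasure P]
  {S : Ω → ℝ} {α β κ : ℝ}

/-- The rate of the Laplace transform of a variable with small-ball constant `κ`. -/
noncomputable def laplaceConst (α β κ A : ℝ) : ℝ :=
  (1 + α) / α * A * (α * (κ * (2 / (1 + α)) ^ (-β)) / A) ^ (1 / (1 + α))

lemma eventually_pos_of_tendsto {F : ℝ → ℝ} (hF0 : ∀ u, 0 ≤ F u) (hκ : 0 < κ)
    (hF : Tendsto (fun ε : ℝ ↦ ε ^ α * |Real.log ε| ^ β * Real.log (F ε)) (𝓝[>] 0) (𝓝 (-κ))) :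
    ∀ᶠ ε in 𝓝[>] 0, 0 < F ε := by
  filter_upwards [hF.eventually_lt_const (show -κ < 0 by linarith)] with ε h
  refine (hF0 ε).lt_of_ne' fun h0 ↦ ?_
  simp [h0] at h

variable (hα : 0 < α) (hκ : 0 < κ) (hS : Measurable S) (hS0 : ∀ ω, 0 ≤ S ω)
  (hF : Tendsto (fun ε : ℝ ↦ ε ^ α * |Real.log ε| ^ β * Real.log (P.real {ω | S ω ≤ ε}))
    (𝓝[>] 0) (𝓝 (-κ)))

include hα hκ hF

omit [IsProbabilityMeasure P] in
lemma eventually_measureReal_clockScale_pos {x : ℝ} (hx : 0 < x) :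
    ∀ᶠ ε in 𝓝[>] 0, 0 < P.real {ω | S ω ≤ x * clockScale α β ε} :=
  (tendsto_scale_zero x _ hx (by positivity)).eventually
    (eventually_pos_of_tendsto (F := fun u ↦ P.real {ω | S ω ≤ u}) (fun _ ↦ measureReal_nonneg)
      hκ hF)

include hS hS0

lemma lowerRate_laplace_of_smallBall {A : ℝ} (hA : 0 < A) :
    LowerRate (𝓝[>] 0) (fun ε ↦ ∫ ω, Real.exp (-(A / ε ^ 2 * S ω)) ∂P) (smallBallRate α β)
      (laplaceConst α β κ A) := by
  have hκ' : 0 < κ * (2 / (1 + α)) ^ (-β) := by positivity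
  rw [laplaceConst, ← mul_add_mul_rpow_optimum hα hA hκ']
  have hx : 0 < (α * (κ * (2 / (1 + α)) ^ (-β)) / A) ^ (1 / (1 + α)) := by positivity
  exact lowerRate_laplace hS hS0 (Eventually.of_forall fun ε ↦ by positivity)
    (mul_clockScale β hα A)
    (lowerRate_of_tendsto (tendsto_smallBallRate β hα)
      (eventually_measureReal_clockScale_pos hα hκ hF hx)
      (tendsto_log_clockScale β hα (F := fun u ↦ P.real {ω | S ω ≤ u}) hF hx))

lemma upperRate_laplace_of_smallBall {A q : ℝ} (hA : 0 < A) (hq0 : 0 < q) (hq : q ≤ 1) :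
    UpperRate (𝓝[>] 0) (fun ε ↦ ∫ ω, Real.exp (-(q * A / ε ^ 2 * S ω)) ∂P) (smallBallRate α β)
      (q * laplaceConst α β κ A) := by
  have hκ' : 0 < κ * (2 / (1 + α)) ^ (-β) := by positivity
  refine upperRate_laplace (A := q * A)
    (φ := fun x ↦ κ * (2 / (1 + α)) ^ (-β) * x ^ (-α)) (tendsto_smallBallRate β hα) hS hS0
    (Eventually.of_forall fun ε ↦ by positivity) (mul_clockScale β hα (q * A)) (by positivity)
    (fun x hx ↦ upperRate_of_tendsto (tendsto_smallBallRate β hα)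
      (eventually_measureReal_clockScale_pos hα hκ hF hx)
      (tendsto_log_clockScale β hα (F := fun u ↦ P.real {ω | S ω ≤ u}) hF hx)) fun x hx ↦ ?_
  have h1 := le_mul_add_mul_rpow hα hA hκ' hx
  calc q * laplaceConst α β κ A ≤ q * (A * x + κ * (2 / (1 + α)) ^ (-β) * x ^ (-α)) := by
        gcongr
        exact h1
    _ = q * A * x + q * (κ * (2 / (1 + α)) ^ (-β) * x ^ (-α)) := by ring
    _ ≤ q * A * x + 1 * (κ * (2 / (1 + α)) ^ (-β) * x ^ (-α)) := by gcongr
    _ = _ := by rw [one_mul]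

end ExponentialTauberian

section Regularisation

variable {Ω : Type*} [mΩ : MeasurableSpace Ω] {P : Measure Ω}

/-- A process with almost surely continuous paths is indistinguishable from a measurable one all of
whose paths are continuous; an almost sure property of paths can be kept. -/
lemma exists_regular_modification {E : Type*} [TopologicalSpace E]
    [TopologicalSpace.PseudoMetrizableSpace E] [MeasurableSpace E] [BorelSpace E] [Zero E]
    {X : ℝ≥0 → Ω → E} (hX : ∀ t, AEMeasurable (X t) P)
    (hc : ∀ᵐ ω ∂P, Continuous fun t ↦ X t ω) {Q : (ℝ≥0 → E) → Prop}
    (hQ : ∀ᵐ ω ∂P, Q fun t ↦ X t ω) (hQ0 : Q fun _ ↦ 0) :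
    ∃ Y : ℝ≥0 → Ω → E, (∀ t, Measurable (Y t)) ∧ (∀ ω, Continuous fun t ↦ Y t ω) ∧
      (∀ ω, Q fun t ↦ Y t ω) ∧ ∀ᵐ ω ∂P, (fun t ↦ X t ω) = fun t ↦ Y t ω := by
  classical
  let d := TopologicalSpace.denseSeq ℝ≥0
  have h1 : ∀ᵐ ω ∂P, ∀ n, X (d n) ω = (hX (d n)).mk _ ω :=
    ae_all_iff.2 fun n ↦ (hX (d n)).ae_eq_mk
  have h2 := hc.and (hQ.and h1)
  set N := toMeasurable P {ω | ¬ ((Continuous fun t ↦ X t ω) ∧ (Q fun t ↦ X t ω) ∧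
    ∀ n, X (d n) ω = (hX (d n)).mk _ ω)} with hN
  have hN0 : P N = 0 := by rw [hN, measure_toMeasurable]; exact h2
  have hNm : MeasurableSet N := measurableSet_toMeasurable _ _
  have hgood {ω : Ω} (hω : ω ∉ N) : (Continuous fun t ↦ X t ω) ∧ (Q fun t ↦ X t ω) ∧
      ∀ n, X (d n) ω = (hX (d n)).mk _ ω := by
    by_contra h
    exact hω (subset_toMeasurable _ _ h)
  let Y : ℝ≥0 → Ω → E := fun t ω ↦ if ω ∈ N then 0 else X t ω
  have hYin {ω : Ω} (hω : ω ∈ N) : (fun t ↦ Y t ω) = fun _ ↦ 0 := by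
    funext t; simp [Y, hω]
  have hYout {ω : Ω} (hω : ω ∉ N) : (fun t ↦ Y t ω) = fun t ↦ X t ω := by
    funext t; simp [Y, hω]
  have hYc (ω : Ω) : Continuous fun t ↦ Y t ω := by
    by_cases hω : ω ∈ N
    · rw [hYin hω]; exact continuous_const
    · rw [hYout hω]; exact (hgood hω).1
  refine ⟨Y, fun t ↦ ?_, hYc, fun ω ↦ ?_, ?_⟩
  · have hd (n : ℕ) : Measurable (Y (d n)) := by
      have : Y (d n) = fun ω ↦ if ω ∈ N then 0 else (hX (d n)).mk _ ω := by
        funext ω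
        by_cases hω : ω ∈ N
        · simp [Y, hω]
        · simp [Y, hω, (hgood hω).2.2 n]
      rw [this]
      exact Measurable.ite hNm measurable_const (hX (d n)).measurable_mk
    obtain ⟨x, hx, hxt⟩ := mem_closure_iff_seq_limit.1
      (TopologicalSpace.denseRange_denseSeq ℝ≥0 t)
    choose n hn using hx
    refine measurable_of_tendsto_metrizable (f := fun k ↦ Y (d (n k))) (fun k ↦ hd _) ?_
    rw [tendsto_pi_nhds]
    intro ω
    have h3 := ((hYc ω).tendsto t).comp hxt
    refine h3.congr fun k ↦ ?_
    simp only [Function.comp_apply, ← hn, d]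
  · by_cases hω : ω ∈ N
    · rw [hYin hω]; exact hQ0
    · rw [hYout hω]; exact (hgood hω).2.1
  · have : ∀ᵐ ω ∂P, ω ∉ N := measure_eq_zero_iff_ae_notMem.1 hN0
    filter_upwards [this] with ω hω using (hYout hω).symm

end Regularisation

section Paths

lemma runningMax_le_iff {Ω : Type*} {B : ℝ≥0 → Ω → ℝ} {C : ℝ≥0 → Ω → ℝ≥0} {ω : Ω}
    (hB : Continuous fun t ↦ B t ω) (hC : Continuous fun t ↦ C t ω) (hCm : Monotone fun t ↦ C t ω)
    (hC0 : C 0 ω = 0) (T : ℝ≥0) (x : ℝ) :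
    runningMax (timeChange B C) T ω ≤ x ↔ ∀ r ≤ C T ω, |B r ω| ≤ x := by
  have hbdd : BddAbove (Set.range fun s : Set.Iic T ↦ |timeChange B C s ω|) := by
    have h1 : Continuous fun s : ℝ≥0 ↦ |B (C s ω) ω| := (hB.comp hC).abs
    have h2 := (isCompact_Icc (a := (0 : ℝ≥0)) (b := T)).bddAbove_image h1.continuousOn
    refine h2.mono ?_
    rintro _ ⟨s, rfl⟩
    exact ⟨s, ⟨zero_le, s.2⟩, rfl⟩
  have : Nonempty (Set.Iic T) := ⟨⟨T, Set.mem_Iic.2 le_rfl⟩⟩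
  rw [runningMax, ciSup_le_iff hbdd]
  constructor
  · intro h r hr
    have h3 := intermediate_value_Icc (zero_le : 0 ≤ T) hC.continuousOn
    obtain ⟨s, hs, rfl⟩ := h3 ⟨by simp [hC0], hr⟩
    exact h ⟨s, hs.2⟩
  · exact fun h s ↦ h _ (hCm s.2)

lemma forall_le_iff_forall_denseSeq_lt {f : ℝ≥0 → ℝ} (hf : Continuous f) {x : ℝ} (h0 : |f 0| ≤ x)
    (c : ℝ≥0) :
    (∀ r ≤ c, |f r| ≤ x) ↔ ∀ n, TopologicalSpace.denseSeq ℝ≥0 n < c →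
      |f (TopologicalSpace.denseSeq ℝ≥0 n)| ≤ x := by
  refine ⟨fun h n hn ↦ h _ hn.le, fun h r hr ↦ ?_⟩
  rcases eq_or_ne c 0 with rfl | hc
  · rwa [nonpos_iff_eq_zero.1 hr]
  have h1 : closure (Set.Iio c) = Set.Iic c := closure_Iio' ⟨0, pos_iff_ne_zero.2 hc⟩
  have h2 := (TopologicalSpace.denseRange_denseSeq ℝ≥0).open_subset_closure_inter
    (isOpen_Iio (a := c))
  have h3 : r ∈ closure (Set.Iio c ∩ Set.range (TopologicalSpace.denseSeq ℝ≥0)) := by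
    have h4 := closure_mono h2
    rw [closure_closure, h1] at h4
    exact h4 hr
  have h5 : IsClosed {r | |f r| ≤ x} := isClosed_le hf.abs continuous_const
  refine h5.closure_subset_iff.2 ?_ h3
  rintro _ ⟨h6, n, rfl⟩
  exact h n h6

end Paths

section Fubini

variable {Ω : Type*} [mΩ : MeasurableSpace Ω] {P : Measure Ω} [IsProbabilityMeasure P]

lemma measurable_measureReal_section {α β : Type*} [MeasurableSpace α]
    [MeasurableSpace β] {X : Ω → α} {Y : Ω → β} (hX : Measurable X)
    (hY : Measurable Y) {T : Set (α × β)} (hT : MeasurableSet T) :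
    Measurable fun ω' ↦ P {ω | (X ω, Y ω') ∈ T} := by
  have h4 := (measurable_measure_prodMk_right (μ := P.map X) hT).comp hY
  have h5 : (fun ω' ↦ P {ω | (X ω, Y ω') ∈ T}) =
      (fun y ↦ (P.map X) ((fun x ↦ (x, y)) ⁻¹' T)) ∘ Y := by
    funext ω'
    rw [Function.comp_apply, Measure.map_apply hX (measurable_prodMk_right hT)]
    rfl
  rwa [h5]

lemma ProbabilityTheory.IndepFun.measureReal_mem_eq_integral {α β : Type*} [MeasurableSpace α]
    [MeasurableSpace β] {X : Ω → α} {Y : Ω → β} (h : IndepFun X Y P) (hX : Measurable X)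
    (hY : Measurable Y) {T : Set (α × β)} (hT : MeasurableSet T) :
    P.real {ω | (X ω, Y ω) ∈ T} = ∫ ω', P.real {ω | (X ω, Y ω') ∈ T} ∂P := by
  have h1 := (indepFun_iff_map_prod_eq_prod_map_map hX.aemeasurable hY.aemeasurable).1 h
  have h2 : P {ω | (X ω, Y ω) ∈ T} = ∫⁻ ω', P {ω | (X ω, Y ω') ∈ T} ∂P := by
    calc P {ω | (X ω, Y ω) ∈ T} = (P.map fun ω ↦ (X ω, Y ω)) T :=
          (Measure.map_apply (hX.prodMk hY) hT).symm
      _ = ∫⁻ y, (P.map X) ((fun x ↦ (x, y)) ⁻¹' T) ∂(P.map Y) := by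
          rw [h1, Measure.prod_apply_symm hT]
      _ = ∫⁻ ω', (P.map X) ((fun x ↦ (x, Y ω')) ⁻¹' T) ∂P :=
          lintegral_map (measurable_measure_prodMk_right hT) hY
      _ = _ := by
          refine lintegral_congr fun ω' ↦ ?_
          rw [Measure.map_apply hX (measurable_prodMk_right hT)]
          rfl
  have h3 := measurable_measureReal_section (P := P) hX hY hT
  rw [measureReal_def, h2, ← integral_toReal h3.aemeasurable
    (ae_of_all _ fun _ ↦ measure_lt_top _ _)]
  rfl

end Fubini

section RandomClock

variable {Ω : Type*} [mΩ : MeasurableSpace Ω] {P : Measure Ω} [IsProbabilityMeasure P]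
  {B : ℝ≥0 → Ω → ℝ} {C : ℝ≥0 → Ω → ℝ≥0} {m : ℕ}

/-- The weighted sum of the clock increments. -/
def clockSum {Ω : Type*} {m : ℕ} (C : ℝ≥0 → Ω → ℝ≥0) (t : Fin (m + 1) → ℝ≥0) (d : Fin m → ℝ)
    (ω : Ω) : ℝ :=
  ∑ i : Fin m, d i * ((C (t i.succ) ω : ℝ) - (C (t i.castSucc) ω : ℝ))

/-- The event that the running maximum of the time-changed process is at most `b i` at time
`t (i + 1)`, for all `i`. -/
def smallMaxEvent {Ω : Type*} {m : ℕ} (B : ℝ≥0 → Ω → ℝ) (C : ℝ≥0 → Ω → ℝ≥0)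
    (t : Fin (m + 1) → ℝ≥0) (b : Fin m → ℝ) : Set Ω :=
  {ω | ∀ i : Fin m, runningMax (timeChange B C) (t i.succ) ω ≤ b i}

lemma measurable_clockSum (hC : ∀ t, Measurable (C t)) (t : Fin (m + 1) → ℝ≥0) (d : Fin m → ℝ) :
    Measurable (clockSum C t d) := by
  have := hC
  unfold clockSum
  fun_prop

omit mΩ in
lemma clockSum_nonneg (hCm : ∀ ω, Monotone fun t ↦ C t ω) {t : Fin (m + 1) → ℝ≥0}
    (ht : Monotone t) {d : Fin m → ℝ} (hd : ∀ i, 0 ≤ d i) (ω : Ω) : 0 ≤ clockSum C t d ω :=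
  Finset.sum_nonneg fun i _ ↦ mul_nonneg (hd i) (sub_nonneg.2
    (NNReal.coe_le_coe.2 (hCm ω (ht (Fin.castSucc_le_succ i)))))

/-- Conditioning on an independent clock. -/
lemma smallMaxEvent_eq_integral
    (hBm : ∀ t, Measurable (B t)) (hBc : ∀ ω, Continuous fun t ↦ B t ω) (hB0 : ∀ ω, B 0 ω = 0)
    (hCme : ∀ t, Measurable (C t)) (hCc : ∀ ω, Continuous fun t ↦ C t ω)
    (hCm : ∀ ω, Monotone fun t ↦ C t ω) (hC0 : ∀ ω, C 0 ω = 0)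
    (hBC : IndepFun (fun ω (t : ℝ≥0) ↦ B t ω) (fun ω (t : ℝ≥0) ↦ C t ω) P)
    (t : Fin (m + 1) → ℝ≥0) {b : Fin m → ℝ} (hb : ∀ i, 0 ≤ b i) :
    P.real (smallMaxEvent B C t b) =
        ∫ ω', P.real (tubesEvent B (fun i ↦ C (t i) ω') b) ∂P ∧
      Integrable (fun ω' ↦ P.real (tubesEvent B (fun i ↦ C (t i) ω') b)) P := by
  let d := TopologicalSpace.denseSeq ℝ≥0
  let T : Set ((ℝ≥0 → ℝ) × (ℝ≥0 → ℝ≥0)) :=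
    {p | ∀ i : Fin m, ∀ n, d n < p.2 (t i.succ) → |p.1 (d n)| ≤ b i}
  have hT : MeasurableSet T := by
    simp only [T, Set.ofPred_forall]
    refine MeasurableSet.iInter fun i ↦ MeasurableSet.iInter fun n ↦ ?_
    have h1 : MeasurableSet {p : (ℝ≥0 → ℝ) × (ℝ≥0 → ℝ≥0) | d n < p.2 (t i.succ)} :=
      measurableSet_lt measurable_const (by fun_prop)
    have h2 : MeasurableSet {p : (ℝ≥0 → ℝ) × (ℝ≥0 → ℝ≥0) | |p.1 (d n)| ≤ b i} :=
      measurableSet_le (by fun_prop) measurable_const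
    have h3 := h1.compl.union h2
    convert h3 using 1
    ext p
    simp [imp_iff_not_or]
  have hX : Measurable fun ω (t : ℝ≥0) ↦ B t ω := measurable_pi_lambda _ hBm
  have hY : Measurable fun ω (t : ℝ≥0) ↦ C t ω := measurable_pi_lambda _ hCme
  have hb0 (ω : Ω) (i : Fin m) : |B 0 ω| ≤ b i := by simpa [hB0] using hb i
  have h1 : smallMaxEvent B C t b = {ω | ((fun t ↦ B t ω), fun t ↦ C t ω) ∈ T} := by
    ext ω
    refine forall_congr' fun i ↦ ?_
    rw [runningMax_le_iff (hBc ω) (hCc ω) (hCm ω) (hC0 ω),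
      forall_le_iff_forall_denseSeq_lt (hBc ω) (hb0 ω i)]
  have h2 (ω' : Ω) : tubesEvent B (fun i ↦ C (t i) ω') b =
      {ω | ((fun t ↦ B t ω), fun t ↦ C t ω') ∈ T} := by
    ext ω
    refine forall_congr' fun i ↦ ?_
    rw [forall_le_iff_forall_denseSeq_lt (hBc ω) (hb0 ω i)]
  simp only [h1, h2]
  refine ⟨hBC.measureReal_mem_eq_integral hX hY hT, ?_⟩
  refine Integrable.of_bound (C := 1) ?_ (ae_of_all _ fun ω ↦ ?_)
  · exact (measurable_measureReal_section (P := P) hX hY hT).ennreal_toReal.aestronglyMeasurable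
  · rw [Real.norm_of_nonneg measureReal_nonneg]
    exact measureReal_le_one

omit mΩ in
lemma sum_eq_clockSum (t : Fin (m + 1) → ℝ≥0) (b : Fin m → ℝ) {q ε : ℝ} (ω : Ω) :
    ∑ i : Fin m, ((C (t i.succ) ω : ℝ) - C (t i.castSucc) ω) *
        (q * (Real.pi / (2 * (b i * ε)))) ^ 2 / 2 =
      q ^ 2 * (Real.pi ^ 2 / 8) / ε ^ 2 * clockSum C t (fun i ↦ (b i ^ 2)⁻¹) ω := by
  rw [clockSum, Finset.mul_sum]
  refine Finset.sum_congr rfl fun i _ ↦ ?_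
  rw [mul_pow, div_pow, mul_pow, mul_pow]
  simp only [div_eq_mul_inv, mul_inv]
  ring

/-- The logarithmic rate of the small-ball probabilities of the running maximum. -/
lemma rates_smallMaxEvent {α β κ : ℝ} (hα : 0 < α) (hκ : 0 < κ) (hB : IsPreBrownianReal B P)
    (hBm : ∀ t, Measurable (B t)) (hBc : ∀ ω, Continuous fun t ↦ B t ω) (hB0 : ∀ ω, B 0 ω = 0)
    (hCme : ∀ t, Measurable (C t)) (hCc : ∀ ω, Continuous fun t ↦ C t ω)
    (hCm : ∀ ω, Monotone fun t ↦ C t ω) (hC0 : ∀ ω, C 0 ω = 0)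
    (hBC : IndepFun (fun ω (t : ℝ≥0) ↦ B t ω) (fun ω (t : ℝ≥0) ↦ C t ω) P)
    {t : Fin (m + 1) → ℝ≥0} (ht0 : t 0 = 0) (ht : Monotone t) {b : Fin m → ℝ}
    (hb : ∀ i, 0 < b i) (hbm : Monotone b)
    (hF : Tendsto (fun ε : ℝ ↦ ε ^ α * |Real.log ε| ^ β *
      Real.log (P.real {ω | clockSum C t (fun i ↦ (b i ^ 2)⁻¹) ω ≤ ε})) (𝓝[>] 0) (𝓝 (-κ))) :
    LowerRate (𝓝[>] 0) (fun ε ↦ P.real (smallMaxEvent B C t fun i ↦ b i * ε))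
        (smallBallRate α β) (laplaceConst α β κ (Real.pi ^ 2 / 8)) ∧
      UpperRate (𝓝[>] 0) (fun ε ↦ P.real (smallMaxEvent B C t fun i ↦ b i * ε))
        (smallBallRate α β) (laplaceConst α β κ (Real.pi ^ 2 / 8)) := by
  have hA : 0 < Real.pi ^ 2 / 8 := by positivity
  set S := clockSum C t (fun i ↦ (b i ^ 2)⁻¹) with hSdef
  have hS : Measurable S := measurable_clockSum hCme _ _
  have hS0 : ∀ ω, 0 ≤ S ω := clockSum_nonneg hCm ht fun i ↦ by positivity
  have hc0 (ω : Ω) : C (t 0) ω = 0 := by rw [ht0, hC0]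
  have hcm (ω : Ω) : Monotone fun i ↦ C (t i) ω := (hCm ω).comp ht
  constructor
  · refine (lowerRate_laplace_of_smallBall hα hκ hS hS0 hF hA).of_le ?_
    filter_upwards [self_mem_nhdsWithin] with ε (hε : 0 < ε)
    obtain ⟨h1, h2⟩ := smallMaxEvent_eq_integral hBm hBc hB0 hCme hCc hCm hC0 hBC t
      (b := fun i ↦ b i * ε) fun i ↦ by have := hb i; positivity
    rw [h1]
    refine integral_mono (integrable_exp_neg_mul hS hS0 (by positivity)) h2 fun ω ↦ ?_
    have h3 := exp_le_measureReal_tubesEvent hB hBm hBc hB0 (hc0 ω) (hcm ω)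
      (b := fun i ↦ b i * ε) (fun i ↦ by have := hb i; positivity)
      (hbm.mul_const hε.le)
    have h4 := sum_eq_clockSum (C := C) t b (q := 1) (ε := ε) ω
    simp only [one_mul, one_pow] at h4
    rwa [h4] at h3
  · have hc : 0 < laplaceConst α β κ (Real.pi ^ 2 / 8) := by
      unfold laplaceConst; positivity
    refine UpperRate.of_forall_lt fun c' hc' ↦ ?_
    obtain ⟨q, hq0, hq1, hq⟩ : ∃ q : ℝ, 0 < q ∧ q < 1 ∧
        c' < q ^ 2 * laplaceConst α β κ (Real.pi ^ 2 / 8) := by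
      have h1 : Tendsto (fun q : ℝ ↦ q ^ 2 * laplaceConst α β κ (Real.pi ^ 2 / 8)) (𝓝[<] 1)
          (𝓝 (1 ^ 2 * laplaceConst α β κ (Real.pi ^ 2 / 8))) :=
        ((tendsto_id.mono_left nhdsWithin_le_nhds).pow 2).mul_const _
      rw [one_pow, one_mul] at h1
      have h2 : ∀ᶠ q : ℝ in 𝓝[<] 1, 0 < q :=
        nhdsWithin_le_nhds (lt_mem_nhds one_pos)
      obtain ⟨q, h3, h4, h5⟩ := (h2.and ((eventually_mem_nhdsWithin (s := Set.Iio (1 : ℝ))).and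
        (h1.eventually_const_lt hc'))).exists
      exact ⟨q, h3, h4, h5⟩
    have hcos := cos_mul_pi_div_two_pos hq0 hq1
    have h1 := (upperRate_laplace_of_smallBall hα hκ hS hS0 hF (q := q ^ 2) hA (by positivity)
      (pow_le_one₀ hq0.le hq1.le)).const_mul (tendsto_smallBallRate β hα)
      (C := (Real.cos (q * (Real.pi / 2)))⁻¹ ^ m) (by positivity)
    refine (h1.mono hq.le).of_le ?_
    filter_upwards [self_mem_nhdsWithin] with ε (hε : 0 < ε)
    obtain ⟨h1, h2⟩ := smallMaxEvent_eq_integral hBm hBc hB0 hCme hCc hCm hC0 hBC t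
      (b := fun i ↦ b i * ε) fun i ↦ by have := hb i; positivity
    rw [h1, ← integral_const_mul]
    refine integral_mono h2 ((integrable_exp_neg_mul hS hS0 (by positivity)).const_mul _)
      fun ω ↦ ?_
    have h3 := measureReal_tubesEvent_le hB hBm hBc hB0 (hc0 ω) (hcm ω)
      (b := fun i ↦ b i * ε) (fun i ↦ by have := hb i; positivity)
      (hbm.mul_const hε.le) hq0 hq1
    rwa [sum_eq_clockSum] at h3

end RandomClock

section Constants

lemma inv_sq_rpow {b : ℝ} (hb : 0 < b) (α : ℝ) : ((b ^ 2)⁻¹) ^ α = (b ^ (2 * α))⁻¹ := by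
  rw [Real.inv_rpow (by positivity), Real.rpow_mul hb.le, Real.rpow_two]

lemma laplaceConst_eq {α β σ : ℝ} (hα : 0 < α) (hσ : 0 ≤ σ) :
    laplaceConst α β (σ ^ (1 + α)) (Real.pi ^ 2 / 8) =
      (2 : ℝ) ^ (-β / (1 + α)) * (1 + α) ^ (1 + β / (1 + α)) *
        (Real.pi ^ 2 / (8 * α)) ^ (α / (1 + α)) * σ := by
  have h1 : 0 < 1 + α := by linarith
  have hpi := Real.pi_pos
  set D := Real.pi ^ 2 / (8 * α) with hD
  have hDp : 0 < D := by positivity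
  have e1 : α * (σ ^ (1 + α) * (2 / (1 + α)) ^ (-β)) / (Real.pi ^ 2 / 8) =
      σ ^ (1 + α) * ((2 / (1 + α)) ^ (-β) * D⁻¹) := by
    rw [hD]; field_simp
  have e2 : (1 + α) / α * (Real.pi ^ 2 / 8) = (1 + α) * D := by
    rw [hD]; field_simp
  rw [laplaceConst, e1, e2, Real.mul_rpow (by positivity) (by positivity),
    Real.mul_rpow (by positivity) (by positivity), ← Real.rpow_mul hσ, ← Real.rpow_mul (by positivity),
    mul_one_div_cancel h1.ne', Real.rpow_one, Real.inv_rpow hDp.le,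
    Real.div_rpow (by norm_num) h1.le, Real.rpow_add h1, Real.rpow_one]
  have e3 : α / (1 + α) = 1 - 1 / (1 + α) := by field_simp; ring
  have e4 : -β * (1 / (1 + α)) = -β / (1 + α) := by ring
  have e5 : (1 + α) ^ (-β / (1 + α)) = ((1 + α) ^ (β / (1 + α)))⁻¹ := by
    rw [neg_div, Real.rpow_neg h1.le]
  rw [e3, Real.rpow_sub hDp, Real.rpow_one, e4, e5]
  field_simp

end Constants

theorem tendsto_log_measureReal_runningMax_of_regular {Ω : Type*} [MeasurableSpace Ω]
    {P : Measure Ω} [IsProbabilityMeasure P]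
    {B : ℝ≥0 → Ω → ℝ} {C : ℝ≥0 → Ω → ℝ≥0} {α β : ℝ} {K : ℝ≥0 → ℝ≥0 → ℝ}
    (hα : 0 < α) (hB : IsPreBrownianReal B P)
    (hBm : ∀ t, Measurable (B t)) (hBc : ∀ ω, Continuous fun t ↦ B t ω) (hB0 : ∀ ω, B 0 ω = 0)
    (hCme : ∀ t, Measurable (C t)) (hCc : ∀ ω, Continuous fun t ↦ C t ω)
    (hCm : ∀ ω, Monotone fun t ↦ C t ω) (hC0 : ∀ ω, C 0 ω = 0)
    (hBC : IndepFun (fun ω (t : ℝ≥0) ↦ B t ω) (fun ω (t : ℝ≥0) ↦ C t ω) P)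
    {m : ℕ} (hm : m ≠ 0) {t : Fin (m + 1) → ℝ≥0} (ht0 : t 0 = 0) (ht : StrictMono t)
    (hK : ∀ i : Fin m, 0 < K (t i.castSucc) (t i.succ))
    (hsb : ∀ d : Fin m → ℝ, (∀ i, 0 < d i) → StrictAnti d →
      Tendsto (fun ε : ℝ ↦ ε ^ α * |Real.log ε| ^ β * Real.log (P.real {ω | clockSum C t d ω ≤ ε}))
        (𝓝[>] 0)
        (𝓝 (-(∑ i : Fin m, (d i ^ α * K (t i.castSucc) (t i.succ)) ^ (1 / (1 + α))) ^ (1 + α))))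
    {a b : Fin m → ℝ} (ha : ∀ i, 0 ≤ a i) (hab : ∀ i, a i < b i)
    (hba : ∀ i j, i < j → b i ≤ a j) :
    Tendsto
      (fun ε : ℝ ↦ (smallBallRate α β ε)⁻¹ *
        Real.log (P.real (⋂ i : Fin m, {ω |
          a i * ε ≤ runningMax (timeChange B C) (t i.succ) ω ∧
          runningMax (timeChange B C) (t i.succ) ω ≤ b i * ε})))
      (𝓝[>] 0)
      (𝓝 (-((2 : ℝ) ^ (-β / (1 + α)) * (1 + α) ^ (1 + β / (1 + α)) *
        (Real.pi ^ 2 / (8 * α)) ^ (α / (1 + α)) *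
        ∑ i : Fin m, (K (t i.castSucc) (t i.succ) / b i ^ (2 * α)) ^ (1 / (1 + α))))) := by
  have hα1 : 0 < 1 + α := by linarith
  have : Nonempty (Fin m) := ⟨⟨0, Nat.pos_of_ne_zero hm⟩⟩
  set L := (2 : ℝ) ^ (-β / (1 + α)) * (1 + α) ^ (1 + β / (1 + α)) *
    (Real.pi ^ 2 / (8 * α)) ^ (α / (1 + α)) with hL
  have hL0 : 0 < L := by positivity
  set c : (Fin m → ℝ) → ℝ := fun b ↦
    L * ∑ i : Fin m, (K (t i.castSucc) (t i.succ) / b i ^ (2 * α)) ^ (1 / (1 + α)) with hcdef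
  have hr := tendsto_smallBallRate β hα
  have hrates (b : Fin m → ℝ) (hb : ∀ i, 0 < b i) (hbm : StrictMono b) :
      LowerRate (𝓝[>] 0) (fun ε ↦ P.real (smallMaxEvent B C t fun i ↦ b i * ε))
        (smallBallRate α β) (c b) ∧
      UpperRate (𝓝[>] 0) (fun ε ↦ P.real (smallMaxEvent B C t fun i ↦ b i * ε))
        (smallBallRate α β) (c b) := by
    have h1 := hsb (fun i ↦ (b i ^ 2)⁻¹) (fun i ↦ by have := hb i; positivity) fun i j hij ↦ by
      have := hb i
      have := hbm hij
      simp only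
      gcongr
    have h2 (i : Fin m) : ((b i ^ 2)⁻¹) ^ α * K (t i.castSucc) (t i.succ) =
        K (t i.castSucc) (t i.succ) / b i ^ (2 * α) := by
      rw [inv_sq_rpow (hb i), div_eq_mul_inv, mul_comm]
    simp only [h2] at h1
    have h3 : 0 < ∑ i : Fin m, (K (t i.castSucc) (t i.succ) / b i ^ (2 * α)) ^ (1 / (1 + α)) :=
      Finset.sum_pos (fun i _ ↦ by have := hb i; have := hK i; positivity) Finset.univ_nonempty
    have h4 := rates_smallMaxEvent hα (by positivity) hB hBm hBc hB0 hCme hCc hCm hC0 hBC ht0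
      ht.monotone hb hbm.monotone h1
    rwa [laplaceConst_eq hα h3.le] at h4
  have hb0 (i : Fin m) : 0 < b i := (ha i).trans_lt (hab i)
  have hbm : StrictMono b := fun i j hij ↦ (hba i j hij).trans_lt (hab j)
  obtain ⟨hlow, hup⟩ := hrates b hb0 hbm
  let b' : Fin m → Fin m → ℝ := fun j ↦ Function.update b j ((a j + b j) / 2)
  have hb'self (j : Fin m) : b' j j = (a j + b j) / 2 := by simp [b']
  have hb'ne {i j : Fin m} (h : i ≠ j) : b' j i = b i := by simp [b', h]
  have hb'0 (j i : Fin m) : 0 < b' j i := by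
    rcases eq_or_ne i j with rfl | h
    · rw [hb'self]
      linarith [ha i, hb0 i]
    · rw [hb'ne h]; exact hb0 i
  have hb'm (j : Fin m) : StrictMono (b' j) := by
    intro i k hik
    rcases eq_or_ne i j with rfl | hi
    · rw [hb'self, hb'ne hik.ne']
      linarith [hab i, hbm hik]
    · rw [hb'ne hi]
      rcases eq_or_ne k j with rfl | hk
      · rw [hb'self]
        linarith [hab k, hba i k hik]
      · rw [hb'ne hk]; exact hbm hik
  have hcb (j : Fin m) : c b < c (b' j) := by
    refine mul_lt_mul_of_pos_left (Finset.sum_lt_sum (fun i _ ↦ ?_) ⟨j, Finset.mem_univ j, ?_⟩) hL0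
    · have h1 := hb'0 j i
      have h2 : b' j i ≤ b i := by
        rcases eq_or_ne i j with rfl | h
        · rw [hb'self]; linarith [hab i]
        · rw [hb'ne h]
      have h3 := hK i
      have h4 := hb0 i
      gcongr
    · have h1 := hb'0 j j
      have h2 : b' j j < b j := by rw [hb'self]; linarith [hab j]
      have h3 := hK j
      have h4 := hb0 j
      gcongr
  obtain ⟨c', hc1, hc2⟩ : ∃ c', c b < c' ∧ ∀ j, c' ≤ c (b' j) := by
    obtain ⟨j, hj⟩ := Finite.exists_min fun j ↦ c (b' j)
    exact ⟨_, hcb j, hj⟩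
  have hsum : UpperRate (𝓝[>] 0) (fun ε ↦ ∑ j, P.real (smallMaxEvent B C t fun i ↦ b' j i * ε))
      (smallBallRate α β) c' :=
    UpperRate.sum hr _ fun j _ ↦ (hrates (b' j) (hb'0 j) (hb'm j)).2.mono (hc2 j)
  refine tendsto_of_rates hr (hup.of_le (Eventually.of_forall fun ε ↦ ?_))
    ((hlow.sub hr hsum hc1).of_le ?_)
  · refine measureReal_mono fun ω hω i ↦ ?_
    exact (Set.mem_iInter.1 hω i).2
  · filter_upwards [self_mem_nhdsWithin] with ε (hε : 0 < ε)
    rw [sub_le_iff_le_add]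
    refine le_trans (measureReal_mono ?_) ((measureReal_union_le _ _).trans
      (add_le_add_right (measureReal_iUnion_fintype_le
        fun j ↦ smallMaxEvent B C t fun i ↦ b' j i * ε) _))
    intro ω hω
    by_cases h : ∀ i, a i * ε ≤ runningMax (timeChange B C) (t i.succ) ω
    · exact Or.inl (Set.mem_iInter.2 fun i ↦ ⟨h i, hω i⟩)
    · push Not at h
      obtain ⟨j, hj⟩ := h
      refine Or.inr (Set.mem_iUnion.2 ⟨j, fun i ↦ ?_⟩)
      rcases eq_or_ne i j with rfl | hi
      · refine hj.le.trans ?_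
        simp only [hb'self]
        gcongr
        linarith [hab i]
      · simp only [hb'ne hi]
        exact hω i

theorem theoremt {Ω : Type*} [MeasurableSpace Ω] (P : Measure Ω) [IsProbabilityMeasure P]
    (B : ℝ≥0 → Ω → ℝ) (C : ℝ≥0 → Ω → ℝ≥0) (α β : ℝ) (K : ℝ≥0 → ℝ≥0 → ℝ)
    (hC : IsSmallBallClock C P α β K)
    (hB : IsBrownianReal B P)
    (hBC : IndepFun (fun ω (t : ℝ≥0) ↦ B t ω) (fun ω (t : ℝ≥0) ↦ C t ω) P)
    (m : ℕ) (t : Fin (m + 1) → ℝ≥0) (ht0 : t 0 = 0) (ht : StrictMono t)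
    (a b : Fin m → ℝ) (ha : ∀ i, 0 ≤ a i) (hab : ∀ i, a i < b i)
    (hba : ∀ i j, i < j → b i ≤ a j) :
    Tendsto
      (fun ε : ℝ ↦ ε ^ (2 * α / (1 + α)) * |Real.log ε| ^ (β / (1 + α)) *
        Real.log (P.real (⋂ i : Fin m, {ω |
          a i * ε ≤ runningMax (timeChange B C) (t i.succ) ω ∧
          runningMax (timeChange B C) (t i.succ) ω ≤ b i * ε})))
      (𝓝[>] 0)
      (𝓝 (-(2 : ℝ) ^ (-β / (1 + α)) * (1 + α) ^ (1 + β / (1 + α)) *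
        (Real.pi ^ 2 / (8 * α)) ^ (α / (1 + α)) *
        ∑ i : Fin m, (K (t i.castSucc) (t i.succ) / b i ^ (2 * α)) ^ (1 / (1 + α)))) := by
  obtain ⟨B', hBm, hBc, hB0, hBB⟩ := exists_regular_modification (Q := fun f ↦ f 0 = 0)
    hB.aemeasurable hB.cont hB.eval_zero_ae_eq_zero rfl
  obtain ⟨C', hCme, hCc, hCQ, hCC⟩ := exists_regular_modification
    (Q := fun f ↦ Monotone f ∧ f 0 = 0) hC.aemeasurable hC.continuous
    (hC.monotone.and hC.zero) ⟨monotone_const, rfl⟩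
  have hα := hC.alpha_pos
  have hα1 : 0 < 1 + α := by linarith
  rcases eq_or_ne m 0 with rfl | hm
  · simp
  have hsb (d : Fin m → ℝ) (hd : ∀ i, 0 < d i) (hda : StrictAnti d) :
      Tendsto (fun ε : ℝ ↦ ε ^ α * |Real.log ε| ^ β * Real.log (P.real {ω | clockSum C' t d ω ≤ ε}))
        (𝓝[>] 0)
        (𝓝 (-(∑ i : Fin m, (d i ^ α * K (t i.castSucc) (t i.succ)) ^ (1 / (1 + α))) ^ (1 + α))) := by
    refine (hC.small_ball m d t hd hda ht0 ht).congr fun ε ↦ ?_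
    congr 2
    refine measureReal_congr ?_
    filter_upwards [hCC] with ω hω
    have h1 (s : ℝ≥0) : C s ω = C' s ω := congrFun hω s
    refine propext ?_
    change _ ≤ ε ↔ clockSum C' t d ω ≤ ε
    simp only [clockSum, h1]
  have key := tendsto_log_measureReal_runningMax_of_regular hα
    (hB.toIsPreBrownianReal.congr fun s ↦ hBB.mono fun ω hω ↦ congrFun hω s) hBm hBc hB0 hCme hCc
    (fun ω ↦ (hCQ ω).1) (fun ω ↦ (hCQ ω).2) (hBC.congr hBB hCC) hm ht0 ht
    (fun i ↦ hC.K_pos _ _ (ht i.castSucc_lt_succ)) hsb ha hab hba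
  rw [neg_mul, neg_mul, neg_mul]
  refine key.congr' ?_
  filter_upwards [self_mem_nhdsWithin] with ε (hε : 0 < ε)
  have h1 : P.real (⋂ i : Fin m, {ω |
      a i * ε ≤ runningMax (timeChange B' C') (t i.succ) ω ∧
      runningMax (timeChange B' C') (t i.succ) ω ≤ b i * ε}) = P.real (⋂ i : Fin m, {ω |
      a i * ε ≤ runningMax (timeChange B C) (t i.succ) ω ∧
      runningMax (timeChange B C) (t i.succ) ω ≤ b i * ε}) := by
    refine measureReal_congr ?_
    filter_upwards [hBB, hCC] with ω h2 h3
    have h4 (s : ℝ≥0) : runningMax (timeChange B' C') s ω = runningMax (timeChange B C) s ω := by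
      have h5 (s : ℝ≥0) : C' s ω = C s ω := (congrFun h3 s).symm
      have h6 (s : ℝ≥0) : B' s ω = B s ω := (congrFun h2 s).symm
      simp only [runningMax, timeChange, h5, h6]
    refine propext ?_
    change ω ∈ (⋂ i : Fin m, _) ↔ ω ∈ (⋂ i : Fin m, _)
    simp only [Set.mem_iInter, Set.mem_ofPred_eq, h4]
  rw [h1, smallBallRate, mul_inv, ← Real.rpow_neg hε.le, ← Real.rpow_neg (abs_nonneg _), neg_neg,
    neg_neg]
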